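/- All manifolds are finite dimensional, Hausdorff, second countable and without boundary, and everything is $C^\infty$. **Discrete tangent bundles.** A discrete tangent bundle of an $n$-dimensional manifold $\mathcal Q$ is a $2n$-dimensional manifold $\mathcal V$ with submersions $\partial^+,\partial^-:\mathcal V\to\mathcal Q$ such that $\ker T\partial^+\cap\ker T\partial^-=0$ and such that for every $q\in\mathcal Q$ there is exactly one $v\in\mathcal V$ with $\partial^+(v)=\partial^-(v)=q$. Put $\operatorname{vert}^{+}=\ker T\partial^{+}$ and $\operatorname{vert}^{-}=\ker T\partial^{-}$. For $v\in\mathcal V$, a vector $\delta q\in T_{\partial^+(v)}\mathcal Q$ has a unique lift $\delta q^+\in\operatorname{vert}^-_v$ with $T\partial^+(\delta q^+)=\delta q$, and a vector $\delta q\in T_{\partial^-(v)}\mathcal Q$ has a unique lift $\delta q^-\in\operatorname{vert}^+_v$ with $T\partial^-(\delta q^-)=\delta q$; for $\delta v\in T_v\mathcal V$ put $\delta v^{+}=(T\partial^{+}\delta v)^{+}$ and $\delta v^{-}=(T\partial^{-}\delta v)^{-}$, so that $\delta v=\delta v^++\delta v^-$. For a one-form $\sigma$ on $\mathcal V$, $v\in\mathcal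 V$, $\delta q\in T_{\partial^-(v)}\mathcal Q$ and $\delta\tilde q\in T_{\partial^+(v)}\mathcal Q$, let $d^\pm\sigma(v)(\delta q,\delta\tilde q)$ be the derivative at $v$, in the direction $\delta\tilde q^+$, of the function $\sigma(X)$, where $X$ is any local vector field with values in $\operatorname{vert}^+$ that lifts, through $\partial^-$, a local vector field on $\mathcal Q$ extending $\delta q$ (the value does not depend on the choice). **Discrete constrained Lagrangian systems.** A DCLS $(\mathcal V,\partial^+,\partial^-,\sigma_d,\mathcal D_d,\mathcal E_d)$ consists of a discrete tangent bundle of $\mathcal Q$, a one-form $\sigma_d$ on $\mathcal V$, an embedded submanifold $\mathcal D_d\subseteq\mathcal V$ such that $\partial^+|\mathcal D_d$ and $\partial^-|\mathcal D_d$ are submersions, and a subbundle $\mathcal E_d$ of $(\partial^+|\mathcal D_d)^*(T\mathcal Q)$. It has linear constraints if there is a constant rank distribution $\mathcal D^{\mathcal Q}_d$ on $\mathcal Q$ such that $(\mathcal E_d)_v=(\mathcal D^{\mathcal Q}_d)_{\partial^+(v)}$ for all $v\in\mathcal D_d$; for every $v\in\mathcal D_d$ there is a piecewise smooth curve tangent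 to $\mathcal D_d^{\mathcal Q}$ from $\partial^-(v)$ to $\partial^+(v)$; and $\dim\mathcal D_d=\dim\mathcal Q+\operatorname{rank}\mathcal D_d^{\mathcal Q}$. It is holonomic if moreover $\mathcal D_d^{\mathcal Q}$ is involutive and $d\sigma_d=0$. **Regularity.** $\sigma_d$ is regular$^-$ if for all $v,\tilde v\in\mathcal D_d$ with $\partial^+(v)=\partial^-(\tilde v)$ and all $\delta q\in T\partial^-(\operatorname{vert}^+_{\tilde v}\cap T_{\tilde v}\mathcal D_d)$: if $d^\pm\sigma_d(\tilde v)(\delta q,\delta\tilde q)=0$ for all $\delta\tilde q\in(\mathcal E_d)_{\tilde v}$, then $\delta q=0$. It is regular$^+$ if for all such $v,\tilde v$ and all $\delta\tilde q\in T\partial^+(\operatorname{vert}^-_{\tilde v}\cap T_{\tilde v}\mathcal D_d)$: if $d^\pm\sigma_d(\tilde v)(\delta q,\delta\tilde q)=0$ for all $\delta q\in(\mathcal E_d)_{v}$, then $\delta\tilde q=0$. It is regular$^\pm$ if it is both regular$^-$ and regular$^+$. **Two-forms.** Let $\theta^+_{\sigma_d}(v)\,\delta v=\sigma_d(v)\,\delta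 v^+$, $\theta^-_{\sigma_d}(v)\,\delta v=-\sigma_d(v)\,\delta v^-$, $\omega^+_{\sigma_d}=-d\theta^+_{\sigma_d}$ and $\omega^-_{\sigma_d}=-d\theta^-_{\sigma_d}$. For $v\in\mathcal D_d$ let $$(\mathcal K^0_{\mathcal D_d})_v=\{\delta v\in T_v\mathcal V:\ T\partial^-(\delta v)\in(\mathcal D_d^{\mathcal Q})_{\partial^-(v)},\ T\partial^+(\delta v)\in(\mathcal D_d^{\mathcal Q})_{\partial^+(v)}\}.$$ **Theorem.** Let $(\mathcal V,\partial^+,\partial^-,\sigma_d,\mathcal D_d,\mathcal E_d)$ be a holonomic DCLS with constraint distribution $\mathcal D_d^{\mathcal Q}$, and suppose that for every $\tilde v\in\mathcal D_d$ there is a $v\in\mathcal D_d$ with $\partial^+(v)=\partial^-(\tilde v)$. Then $\omega^+_{\sigma_d}=\omega^-_{\sigma_d}=:\omega_{\sigma_d}$, and $\sigma_d$ is regular$^\pm$ if and only if $\omega_{\sigma_d}$ is nondegenerate on $\mathcal K^0_{\mathcal D_d}$, i.e. for every $v\in\mathcal D_d$ the only $\delta v\in(\mathcal K^0_{\mathcal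 D_d})_v$ with $\omega_{\sigma_d}(\delta v,\delta w)=0$ for all $\delta w\in(\mathcal K^0_{\mathcal D_d})_v$ is $\delta v=0$. -/

import Mathlib

open Set Topology
open scoped Manifold ContDiff

noncomputable section

namespace DiscreteMechanics

/-! ### Smooth maps, distributions and reachability

`𝓡 n` is the model of boundaryless `n`-dimensional manifolds, `TangentSpace (𝓡 n) q` is the
tangent space at `q`, and `mfderiv` is the tangent map. Smooth means `C^∞`. -/

section Manifolds

variable {m n : ℕ}
  {M : Type*} [TopologicalSpace M] [ChartedSpace (EuclideanSpace ℝ (Fin m)) M]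
  {Q : Type*} [TopologicalSpace Q] [ChartedSpace (EuclideanSpace ℝ (Fin n)) Q]

/-- A smooth map with surjective differentials. -/
structure IsSmoothSubmersion (f : M → Q) : Prop where
  contMDiff : ContMDiff (𝓡 m) (𝓡 n) ∞ f
  surjective : ∀ x, Function.Surjective (mfderiv (𝓡 m) (𝓡 n) f x)

/-- A smooth immersion which is a homeomorphism onto its image: its image is an embedded
submanifold, with tangent space at `f x` the range of the differential of `f` at `x`. -/
structure IsSubmanifoldEmbedding (f : M → Q) : Prop where
  contMDiff : ContMDiff (𝓡 m) (𝓡 n) ∞ f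
  injective : ∀ x, Function.Injective (mfderiv (𝓡 m) (𝓡 n) f x)
  isEmbedding : IsEmbedding f

/-- `F` is a smooth rank `k` subbundle of the pullback bundle `f^*(TQ)`: it is spanned, locally, by
`k` pointwise linearly independent smooth sections of `f^*(TQ)`, i.e. smooth vector fields
along `f`. -/
def IsSubbundleAlong [IsManifold (𝓡 n) ∞ Q] (f : M → Q)
    (F : ∀ x : M, Submodule ℝ (TangentSpace (𝓡 n) (f x))) (k : ℕ) : Prop :=
  ∀ x₀ : M, ∃ U : Set M, IsOpen U ∧ x₀ ∈ U ∧
    ∃ s : Fin k → ∀ x : M, TangentSpace (𝓡 n) (f x),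
      (∀ i, ContMDiffOn (𝓡 m) (𝓡 n).tangent ∞
        (fun x => (⟨f x, s i x⟩ : TangentBundle (𝓡 n) Q)) U) ∧
      ∀ x ∈ U, LinearIndependent ℝ (fun i => s i x) ∧
        Submodule.span ℝ (Set.range fun i => s i x) = F x

/-- `F` is a smooth distribution of rank `k` on `Q`, i.e. a subbundle of `TQ`. -/
def IsDistribution [IsManifold (𝓡 n) ∞ Q]
    (F : ∀ q : Q, Submodule ℝ (TangentSpace (𝓡 n) q)) (k : ℕ) : Prop :=
  IsSubbundleAlong (m := n) (fun q : Q => q) F k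

/-- The bracket of two (local) smooth vector fields with values in `F` has values in `F`. -/
def IsInvolutive [IsManifold (𝓡 n) ∞ Q]
    (F : ∀ q : Q, Submodule ℝ (TangentSpace (𝓡 n) q)) : Prop :=
  ∀ U : Set Q, IsOpen U → ∀ X Y : ∀ q : Q, TangentSpace (𝓡 n) q,
    ContMDiffOn (𝓡 n) (𝓡 n).tangent ∞ (fun q => (⟨q, X q⟩ : TangentBundle (𝓡 n) Q)) U →
    ContMDiffOn (𝓡 n) (𝓡 n).tangent ∞ (fun q => (⟨q, Y q⟩ : TangentBundle (𝓡 n) Q)) U →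
    (∀ q ∈ U, X q ∈ F q) → (∀ q ∈ U, Y q ∈ F q) →
    ∀ q ∈ U, VectorField.mlieBracket (𝓡 n) X Y q ∈ F q

/-- There is a smooth curve `c : [a, b] → Q` from `q` to `q'` with `c'(t) ∈ F` for all `t`. -/
def SmoothlyReachable (F : ∀ q : Q, Submodule ℝ (TangentSpace (𝓡 n) q)) (q q' : Q) : Prop :=
  ∃ (a b : ℝ) (c : ℝ → Q), a < b ∧ ContMDiffOn 𝓘(ℝ, ℝ) (𝓡 n) ∞ c (Icc a b) ∧
    (∀ t ∈ Icc a b, mfderivWithin 𝓘(ℝ, ℝ) (𝓡 n) c (Icc a b) t (1 : ℝ) ∈ F (c t)) ∧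
    c a = q ∧ c b = q'

/-- `q'` is `F`-reachable from `q`: a piecewise smooth curve tangent to `F`, i.e. a finite
concatenation of smooth ones, leads from `q` to `q'`. -/
def Reachable (F : ∀ q : Q, Submodule ℝ (TangentSpace (𝓡 n) q)) : Q → Q → Prop :=
  Relation.ReflTransGen (SmoothlyReachable F)

/-- The local vector field near `q` that extends `a ∈ T_qQ` and is constant in the chart at `q`. -/
def extendVector (q : Q) (a : TangentSpace (𝓡 n) q) (y : Q) : TangentSpace (𝓡 n) y :=
  mfderiv 𝓘(ℝ, EuclideanSpace ℝ (Fin n)) (𝓡 n) (extChartAt (𝓡 n) q).symm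
    (extChartAt (𝓡 n) q y)
    (mfderiv (𝓡 n) 𝓘(ℝ, EuclideanSpace ℝ (Fin n)) (extChartAt (𝓡 n) q) q a)

/-! ### One-forms and their exterior derivatives -/

/-- A (not necessarily smooth) one-form on `M`. -/
abbrev OneForm (m : ℕ) (M : Type*) [TopologicalSpace M]
    [ChartedSpace (EuclideanSpace ℝ (Fin m)) M] :=
  ∀ x : M, TangentSpace (𝓡 m) x →L[ℝ] ℝ

/-- A one-form is smooth if it is smooth as a (fibrewise linear) function on the tangent bundle. -/
def OneForm.IsSmooth [IsManifold (𝓡 m) ∞ M] (θ : OneForm m M) : Prop :=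
  ContMDiff (𝓡 m).tangent 𝓘(ℝ, ℝ) ∞ (fun w : TangentBundle (𝓡 m) M => θ w.proj w.snd)

/-- The expression of `θ` in the chart `φ` at `x₀`, i.e. the one-form `(φ⁻¹)^*θ`. -/
def OneForm.inChart (θ : OneForm m M) (x₀ : M) (y : EuclideanSpace ℝ (Fin m)) :
    EuclideanSpace ℝ (Fin m) →L[ℝ] ℝ :=
  (θ ((extChartAt (𝓡 m) x₀).symm y)).comp
    (mfderiv 𝓘(ℝ, EuclideanSpace ℝ (Fin m)) (𝓡 m) (extChartAt (𝓡 m) x₀).symm y)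

/-- The exterior derivative `dθ(x)(a, b)`, computed in the chart at `x` by
`dϑ(a, b) = (D_a ϑ)(b) - (D_b ϑ)(a)`. -/
def OneForm.d (θ : OneForm m M) (x : M) (a b : TangentSpace (𝓡 m) x) : ℝ :=
  let φ := extChartAt (𝓡 m) x
  let a' : EuclideanSpace ℝ (Fin m) := mfderiv (𝓡 m) 𝓘(ℝ, EuclideanSpace ℝ (Fin m)) φ x a
  let b' : EuclideanSpace ℝ (Fin m) := mfderiv (𝓡 m) 𝓘(ℝ, EuclideanSpace ℝ (Fin m)) φ x b
  fderiv ℝ (θ.inChart x) (φ x) a' b' - fderiv ℝ (θ.inChart x) (φ x) b' a'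

end Manifolds

/-! ### Discrete tangent bundles -/

section Discrete

variable (n : ℕ) (V Q : Type*)
  [TopologicalSpace V] [ChartedSpace (EuclideanSpace ℝ (Fin (2 * n))) V]
  [TopologicalSpace Q] [ChartedSpace (EuclideanSpace ℝ (Fin n)) Q]

/-- A discrete tangent bundle `(V, ∂⁺, ∂⁻)` of the `n`-dimensional manifold `Q`. -/
structure DiscreteTangentBundle where
  /-- the boundary map `∂⁺` -/
  plus : V → Q
  /-- the boundary map `∂⁻` -/
  minus : V → Q
  submersion_plus : IsSmoothSubmersion (m := 2 * n) (n := n) plus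
  submersion_minus : IsSmoothSubmersion (m := 2 * n) (n := n) minus
  ker_inf_ker : ∀ v (δv : TangentSpace (𝓡 (2 * n)) v),
    mfderiv (𝓡 (2 * n)) (𝓡 n) plus v δv = 0 →
    mfderiv (𝓡 (2 * n)) (𝓡 n) minus v δv = 0 → δv = 0
  existsUnique_zero : ∀ q : Q, ∃! v : V, plus v = q ∧ minus v = q

namespace DiscreteTangentBundle

variable {n V Q}
variable (B : DiscreteTangentBundle n V Q)

/-- `T_v∂⁺` -/
def Tplus (v : V) : TangentSpace (𝓡 (2 * n)) v →L[ℝ] TangentSpace (𝓡 n) (B.plus v) :=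
  mfderiv (𝓡 (2 * n)) (𝓡 n) B.plus v

/-- `T_v∂⁻` -/
def Tminus (v : V) : TangentSpace (𝓡 (2 * n)) v →L[ℝ] TangentSpace (𝓡 n) (B.minus v) :=
  mfderiv (𝓡 (2 * n)) (𝓡 n) B.minus v

/-- `vert⁺_v = ker T_v∂⁺` -/
def vertPlus (v : V) : Submodule ℝ (TangentSpace (𝓡 (2 * n)) v) :=
  LinearMap.ker (B.Tplus v).toLinearMap

/-- `vert⁻_v = ker T_v∂⁻` -/
def vertMinus (v : V) : Submodule ℝ (TangentSpace (𝓡 (2 * n)) v) :=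
  LinearMap.ker (B.Tminus v).toLinearMap

/-- The tangent map `(T_v∂⁺, T_v∂⁻)` of `∂^± = (∂⁺, ∂⁻)`. -/
def Tboth (v : V) : TangentSpace (𝓡 (2 * n)) v →L[ℝ]
    TangentSpace (𝓡 n) (B.plus v) × TangentSpace (𝓡 n) (B.minus v) :=
  (B.Tplus v).prod (B.Tminus v)

/-- The tangent map of `∂^±` is a linear isomorphism. -/
theorem Tboth_isInvertible (v : V) : (B.Tboth v).IsInvertible := by
  have hinj : Function.Injective (B.Tboth v).toLinearMap := by
    rw [← LinearMap.ker_eq_bot, LinearMap.ker_eq_bot']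
    intro w hw
    exact B.ker_inf_ker v w (congrArg Prod.fst hw) (congrArg Prod.snd hw)
  let L : EuclideanSpace ℝ (Fin (2 * n)) →ₗ[ℝ]
      EuclideanSpace ℝ (Fin n) × EuclideanSpace ℝ (Fin n) := (B.Tboth v).toLinearMap
  have hfin : Module.finrank ℝ (EuclideanSpace ℝ (Fin (2 * n))) =
      Module.finrank ℝ (EuclideanSpace ℝ (Fin n) × EuclideanSpace ℝ (Fin n)) := by
    simp [Module.finrank_prod]; ring
  let e := (LinearEquiv.ofInjectiveOfFinrankEq L hinj hfin).toContinuousLinearEquiv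
  exact ⟨e, rfl⟩

/-- `δq⁺`: the unique `δv ∈ vert⁻_v` with `T∂⁺(δv) = δq`. -/
def liftPlus (v : V) : TangentSpace (𝓡 n) (B.plus v) →L[ℝ] TangentSpace (𝓡 (2 * n)) v :=
  (B.Tboth v).inverse.comp (ContinuousLinearMap.inl ℝ _ _)

/-- `δq⁻`: the unique `δv ∈ vert⁺_v` with `T∂⁻(δv) = δq`. -/
def liftMinus (v : V) : TangentSpace (𝓡 n) (B.minus v) →L[ℝ] TangentSpace (𝓡 (2 * n)) v :=
  (B.Tboth v).inverse.comp (ContinuousLinearMap.inr ℝ _ _)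

theorem Tboth_inverse_apply (v : V)
    (w : TangentSpace (𝓡 n) (B.plus v) × TangentSpace (𝓡 n) (B.minus v)) :
    B.Tboth v ((B.Tboth v).inverse w) = w := by
  obtain ⟨e, he⟩ := B.Tboth_isInvertible v
  rw [← he, ContinuousLinearMap.inverse_equiv]
  exact e.apply_symm_apply w

theorem Tplus_liftPlus (v : V) (a) : B.Tplus v (B.liftPlus v a) = a :=
  congrArg Prod.fst (B.Tboth_inverse_apply v (a, 0))

theorem Tminus_liftPlus (v : V) (a) : B.Tminus v (B.liftPlus v a) = 0 :=
  congrArg Prod.snd (B.Tboth_inverse_apply v (a, 0))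

theorem Tplus_liftMinus (v : V) (a) : B.Tplus v (B.liftMinus v a) = 0 :=
  congrArg Prod.fst (B.Tboth_inverse_apply v (0, a))

theorem Tminus_liftMinus (v : V) (a) : B.Tminus v (B.liftMinus v a) = a :=
  congrArg Prod.snd (B.Tboth_inverse_apply v (0, a))

/-- The bilinear form `d^±θ(v)(δq, δq')`, for `δq ∈ T_{∂⁻(v)}Q` and `δq' ∈ T_{∂⁺(v)}Q`: the
derivative at `v`, in the direction of the vector `δq'⁺ ∈ vert⁻_v`, of the function `θ(X)`, where
`X` is the local vector field with values in `vert⁺` that lifts, through `∂⁻`, a local vector field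
on `Q` extending `δq`. (The value does not depend on this extension, as `∂⁻` is
constant to first order in the direction `δq'⁺`; the one that is constant in a chart is used.) -/
def dpm (θ : OneForm (2 * n) V) (v : V) (δq : TangentSpace (𝓡 n) (B.minus v))
    (δq' : TangentSpace (𝓡 n) (B.plus v)) : ℝ :=
  mfderiv (𝓡 (2 * n)) 𝓘(ℝ, ℝ)
    (fun x : V => θ x (B.liftMinus x (extendVector (n := n) (B.minus v) δq (B.minus x)))) v
    (B.liftPlus v δq')

/-- `θ⁺_σ(v)δv = σ(v)δv⁺`, where `δv⁺ = (T∂⁺ δv)⁺` is the `vert⁻_v` part of `δv`. -/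
def thetaPlus (σ : OneForm (2 * n) V) : OneForm (2 * n) V :=
  fun v => (σ v).comp ((B.liftPlus v).comp (B.Tplus v))

/-- `θ⁻_σ(v)δv = -σ(v)δv⁻`, where `δv⁻ = (T∂⁻ δv)⁻` is the `vert⁺_v` part of `δv`. -/
def thetaMinus (σ : OneForm (2 * n) V) : OneForm (2 * n) V :=
  fun v => -(σ v).comp ((B.liftMinus v).comp (B.Tminus v))

/-- The discrete two-form `ω⁺_σ = -dθ⁺_σ`. -/
def omegaPlus (σ : OneForm (2 * n) V) (v : V) (δv δw : TangentSpace (𝓡 (2 * n)) v) : ℝ :=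
  -(OneForm.d (B.thetaPlus σ) v δv δw)

/-- The discrete two-form `ω⁻_σ = -dθ⁻_σ`. -/
def omegaMinus (σ : OneForm (2 * n) V) (v : V) (δv δw : TangentSpace (𝓡 (2 * n)) v) : ℝ :=
  -(OneForm.d (B.thetaMinus σ) v δv δw)

end DiscreteTangentBundle

/-! ### Discrete constrained Lagrangian systems -/

variable (k : ℕ) (D : Type*) [TopologicalSpace D] [ChartedSpace (EuclideanSpace ℝ (Fin k)) D]
variable [IsManifold (𝓡 (2 * n)) ∞ V] [IsManifold (𝓡 n) ∞ Q]

/-- A discrete constrained Lagrangian system `(V, ∂⁺, ∂⁻, σ, 𝒟, ℰ)`. The `k`-dimensional submanifold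
`𝒟` of `V` is the image of the embedding `incl` of a `k`-dimensional manifold `D`; a point of `𝒟`
is `incl x` for a unique `x : D`, and `T_{incl x}𝒟` is the range of `T_x incl`. -/
structure DCLS extends DiscreteTangentBundle n V Q where
  /-- the one-form `σ`, the analogue of the differential of a discrete Lagrangian -/
  σ : OneForm (2 * n) V
  smooth_σ : σ.IsSmooth
  /-- the inclusion of the constraint submanifold -/
  incl : D → V
  embedding_incl : IsSubmanifoldEmbedding (m := k) (n := 2 * n) incl
  submersion_plus_incl : IsSmoothSubmersion (m := k) (n := n) (plus ∘ incl)
  submersion_minus_incl : IsSmoothSubmersion (m := k) (n := n) (minus ∘ incl)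
  /-- the fibre dimension of `ℰ` -/
  fdimE : ℕ
  /-- the subbundle `ℰ` of `(∂⁺|𝒟)^*(TQ)` -/
  E : ∀ x : D, Submodule ℝ (TangentSpace (𝓡 n) (plus (incl x)))
  subbundle_E : IsSubbundleAlong (m := k) (n := n) (fun x : D => plus (incl x)) E fdimE

namespace DCLS

variable {n V Q k D}
variable (C : DCLS n V Q k D)

/-- The tangent space `T_v𝒟` at `v = incl x`. -/
def tangentD (x : D) : Submodule ℝ (TangentSpace (𝓡 (2 * n)) (C.incl x)) :=
  LinearMap.range (mfderiv (𝓡 k) (𝓡 (2 * n)) C.incl x).toLinearMap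

/-- Regularity⁻: for all `v, ṽ ∈ 𝒟` with `∂⁺(v) = ∂⁻(ṽ)` and all
`δq ∈ T∂⁻(vert⁺_ṽ ∩ T_ṽ𝒟)`, if `d^±σ(ṽ)(δq, δq') = 0` for all `δq' ∈ ℰ_ṽ`, then `δq = 0`. -/
def RegularMinus : Prop :=
  ∀ x x' : D, C.plus (C.incl x) = C.minus (C.incl x') →
    ∀ δq ∈ (C.vertPlus (C.incl x') ⊓ C.tangentD x').map (C.Tminus (C.incl x')).toLinearMap,
      (∀ δq' ∈ C.E x', C.dpm C.σ (C.incl x') δq δq' = 0) → δq = 0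

/-- Regularity⁺: for all `v, ṽ ∈ 𝒟` with `∂⁺(v) = ∂⁻(ṽ)` and all
`δq' ∈ T∂⁺(vert⁻_ṽ ∩ T_ṽ𝒟)`, if `d^±σ(ṽ)(δq, δq') = 0` for all `δq ∈ ℰ_v`, then `δq' = 0`. -/
def RegularPlus : Prop :=
  ∀ (x x' : D) (h : C.plus (C.incl x) = C.minus (C.incl x')),
    ∀ δq' ∈ (C.vertMinus (C.incl x') ⊓ C.tangentD x').map (C.Tplus (C.incl x')).toLinearMap,
      (∀ δq ∈ C.E x, C.dpm C.σ (C.incl x') (h ▸ δq) δq' = 0) → δq' = 0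

/-- `σ` is regular if it is regular⁻ and regular⁺. -/
def Regular : Prop := C.RegularMinus ∧ C.RegularPlus

/-- The system has linear constraints, with the rank `r` distribution `F` on `Q`. The manifold `F`
(a vector bundle over `Q`) has dimension `n + r`. -/
structure HasLinearConstraints (F : ∀ q : Q, Submodule ℝ (TangentSpace (𝓡 n) q)) (r : ℕ) :
    Prop where
  distribution : IsDistribution F r
  E_eq : ∀ x : D, C.E x = F (C.plus (C.incl x))
  reachable : ∀ x : D, Reachable F (C.minus (C.incl x)) (C.plus (C.incl x))
  dim_eq : k = n + r

/-- The system is holonomic: it has linear constraints with an involutive distribution `F`, and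
`σ` is closed. -/
structure IsHolonomic (F : ∀ q : Q, Submodule ℝ (TangentSpace (𝓡 n) q)) (r : ℕ) : Prop
    extends C.HasLinearConstraints F r where
  involutive : IsInvolutive F
  closed : ∀ (v : V) (a b : TangentSpace (𝓡 (2 * n)) v), C.σ.d v a b = 0

/-- The fibre at `v` of `𝒦⁰ = (T∂⁻)⁻¹F ∩ (T∂⁺)⁻¹F`. -/
def K0 (F : ∀ q : Q, Submodule ℝ (TangentSpace (𝓡 n) q)) (v : V) :
    Submodule ℝ (TangentSpace (𝓡 (2 * n)) v) :=
  (F (C.minus v)).comap (C.Tminus v).toLinearMap ⊓ (F (C.plus v)).comap (C.Tplus v).toLinearMap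

/-- The two-form `w` on `V` is nondegenerate on the restriction of `𝒦⁰` to `𝒟`. -/
def NondegenerateOnK0 (F : ∀ q : Q, Submodule ℝ (TangentSpace (𝓡 n) q))
    (w : ∀ v : V, TangentSpace (𝓡 (2 * n)) v → TangentSpace (𝓡 (2 * n)) v → ℝ) : Prop :=
  ∀ x : D, ∀ δv ∈ C.K0 F (C.incl x),
    (∀ δw ∈ C.K0 F (C.incl x), w (C.incl x) δv δw = 0) → δv = 0

end DCLS
end Discrete
end DiscreteMechanics
end

open Set Topology
open scoped Manifold ContDiff

noncomputable section

namespace DiscreteMechanics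

/-! Since `δv = δv⁺ + δv⁻`, one has `θ⁺ - θ⁻ = σ`, so closedness of `σ` gives `ω⁺ = ω⁻ = ω`. The
form `θ⁺` factors through `T∂⁺`, and `θ⁻` through `T∂⁻`. Hence `ω` vanishes on pairs of vectors of
`vert⁺` and on pairs of vectors of `vert⁻`, and only a mixed term survives (`omegaPlus_eq_dpm`):
`ω(a, b) = d^±σ(T∂⁻b, T∂⁺a) - d^±σ(T∂⁻a, T∂⁺b)`. As `𝒦⁰` is the sum of the lifts of `F` through `∂⁻`
and through `∂⁺`, nondegeneracy of `ω` on it means that `d^±σ` has neither left nor right kernel on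
`F × F`.

Regularity says the same as soon as `T∂⁻(vert⁺ ∩ T𝒟) = F` and `T∂⁺(vert⁻ ∩ T𝒟) = F` (`map_Tminus`,
`map_Tplus`). By the dimension condition both sides have dimension `r`, so an inclusion suffices. A
vector of `vert⁺ ∩ T𝒟` is the velocity of a curve in a fibre of `∂⁺|𝒟`. Along this curve `∂⁻` is
joined to a fixed point by curves tangent to `F`, so it moves within one leaf.

It remains to see that a curve in a leaf is tangent to `F` (`tangent_of_reachable`), although the
leaf need not be embedded and nothing is known about how the joining curves vary. By second
countability a leaf meets only countably many plaques of a foliation box. A continuous first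
integral therefore takes countably many values on a short piece of the curve, hence is constant
there.

The foliation boxes come from a quantitative Frobenius theorem. A normalized frame of an involutive
distribution commutes, and the first integral sends a point to the end of its trajectory in the
slice `T = T z₀`. Smoothness of the first integral is never needed: a first order estimate, obtained
from Grönwall's inequality, replaces it (`norm_endpoint_sub_le`, `exists_label`). -/

/-! ### Commuting frames and their first integrals -/

section Frobenius

open Metric

variable {E W : Type*} [NormedAddCommGroup E] [NormedSpace ℝ E]
  [NormedAddCommGroup W] [NormedSpace ℝ W]

/-- On the closed ball of radius `R` about `z₀`, the vector fields `z ↦ S z a`, `a : W`, commute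
and are projected by the linear map `T` to the constant vector fields `a`. The constant `K` bounds
`S` and its first two derivatives. -/
structure CommutingFrame (S : E → W →L[ℝ] E) (S' : E → E →L[ℝ] W →L[ℝ] E) (T : E →L[ℝ] W)
    (z₀ : E) (R K : ℝ) : Prop where
  radius_pos : 0 < R
  one_le : 1 ≤ K
  hasFDerivAt : ∀ z ∈ closedBall z₀ R, HasFDerivAt S (S' z) z
  norm_le : ∀ z ∈ closedBall z₀ R, ‖S z‖ ≤ K
  norm_deriv_le : ∀ z ∈ closedBall z₀ R, ‖S' z‖ ≤ K
  lipschitz : ∀ z ∈ closedBall z₀ R, ∀ w ∈ closedBall z₀ R, ‖S w - S z‖ ≤ K * ‖w - z‖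
  taylor : ∀ z ∈ closedBall z₀ R, ∀ w ∈ closedBall z₀ R,
    ‖S w - S z - S' z (w - z)‖ ≤ K * ‖w - z‖ ^ 2
  comm : ∀ z ∈ closedBall z₀ R, ∀ a b, S' z (S z a) b = S' z (S z b) a
  proj : ∀ z ∈ closedBall z₀ R, ∀ a, T (S z a) = a

/-- `α : [0, 1] → E` is an integral curve of the vector field `z ↦ S z a`, which stays well inside
the ball of radius `R` about `z₀`. -/
structure IsTrajectory (S : E → W →L[ℝ] E) (z₀ : E) (R : ℝ) (a : W) (α : ℝ → E) : Prop where
  hasDerivWithinAt : ∀ t ∈ Icc (0 : ℝ) 1, HasDerivWithinAt α (S (α t) a) (Icc 0 1) t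
  -- The margin `R / 4` is what keeps the displaced curve of `norm_endpoint_sub_le` in the ball of
  -- radius `R`.
  dist_le : ∀ t ∈ Icc (0 : ℝ) 1, ‖α t - z₀‖ ≤ 3 * R / 4

namespace IsTrajectory

variable {S : E → W →L[ℝ] E} {z₀ : E} {R : ℝ} {a : W} {α : ℝ → E}

theorem mem (h : IsTrajectory S z₀ R a α) (hR : 0 < R) {t : ℝ} (ht : t ∈ Icc (0 : ℝ) 1) :
    α t ∈ closedBall z₀ R := by
  rw [mem_closedBall_iff_norm]
  linarith [h.dist_le t ht]

theorem continuousOn (h : IsTrajectory S z₀ R a α) : ContinuousOn α (Icc 0 1) :=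
  fun t ht => (h.hasDerivWithinAt t ht).continuousWithinAt

theorem hasDerivWithinAt_Ici (h : IsTrajectory S z₀ R a α) {t : ℝ} (ht : t ∈ Ico (0 : ℝ) 1) :
    HasDerivWithinAt α (S (α t) a) (Ici t) t :=
  (h.hasDerivWithinAt t (Ico_subset_Icc_self ht)).mono_of_mem_nhdsWithin
    (Icc_mem_nhdsGE_of_mem ht)

theorem hasDerivWithinAt_Iic (h : IsTrajectory S z₀ R a α) {t : ℝ} (ht : t ∈ Ioc (0 : ℝ) 1) :
    HasDerivWithinAt α (S (α t) a) (Iic t) t :=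
  (h.hasDerivWithinAt t (Ioc_subset_Icc_self ht)).mono_of_mem_nhdsWithin
    (Icc_mem_nhdsLE_of_mem ht)

end IsTrajectory

/-- A function which is invariant to first order under displacements in the range of `P` has
derivative zero along curves tangent to the range of `P`. -/
theorem hasDerivWithinAt_zero_of_first_order_invariant {F : Type*} [NormedAddCommGroup F]
    [NormedSpace ℝ F] {h : E → F} {N : Set E} {P : W →L[ℝ] E} {T : E →L[ℝ] W} {C : ℝ} {c : ℝ → E}
    {v : E} {s : Set ℝ} {t : ℝ}
    (hh : ∀ z ∈ N, ‖h z - h (c t)‖ ≤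
      C * (‖z - c t - P (T (z - c t))‖ + ‖T (z - c t)‖ ^ 2))
    (hc : HasDerivWithinAt c v s t) (hv : P (T v) = v) (hN : ∀ᶠ x in 𝓝[s] t, c x ∈ N) :
    HasDerivWithinAt (fun x => h (c x)) 0 s t := by
  rw [hasDerivWithinAt_iff_isLittleO] at hc ⊢
  simp only [smul_zero, sub_zero]
  -- `L` kills the velocity `v`, so the first term of the bound is little-o along `c`; the second
  -- one is quadratic in `x - t`.
  let L : E →L[ℝ] E := ContinuousLinearMap.id ℝ E - P.comp T
  have h1 : (fun x => c x - c t - P (T (c x - c t))) =o[𝓝[s] t] fun x => x - t := by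
    refine ((L.isBigO_comp _ _).trans_isLittleO hc).congr_left fun x => ?_
    simp [L, hv]
  have h2 : (fun x => c x - c t) =O[𝓝[s] t] fun x => x - t := by
    have := hc.isBigO.add (Asymptotics.isBigO_of_le' (c := ‖v‖) (𝓝[s] t)
      (f := fun x => (x - t) • v) (g := fun x => x - t)
      (fun x => by rw [norm_smul, mul_comm]))
    simpa using this
  have h3 : (fun x => ‖T (c x - c t)‖ ^ 2) =o[𝓝[s] t] fun x => x - t := by
    have h4 := (((T.isBigO_comp (fun x => c x - c t) _).trans h2).norm_left).pow 2
    refine h4.trans_isLittleO ?_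
    have : Filter.Tendsto (fun x : ℝ => x - t) (𝓝[s] t) (𝓝 0) := by
      have : Continuous fun x : ℝ => x - t := by fun_prop
      simpa using (this.tendsto t).mono_left nhdsWithin_le_nhds
    have h5 := (Asymptotics.isLittleO_one_iff ℝ).2 this
    simpa [sq] using h5.mul_isBigO (Asymptotics.isBigO_refl (fun x : ℝ => x - t) _)
  refine Asymptotics.IsBigO.trans_isLittleO ?_ ((h1.norm_left.add h3).const_mul_left C)
  refine Asymptotics.IsBigO.of_bound 1 ?_
  filter_upwards [hN] with x hx
  rw [one_mul]
  exact (hh _ hx).trans (le_abs_self _)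

namespace CommutingFrame

variable {S : E → W →L[ℝ] E} {S' : E → E →L[ℝ] W →L[ℝ] E} {T : E →L[ℝ] W} {z₀ : E} {R K : ℝ}

theorem lipschitzOnWith (H : CommutingFrame S S' T z₀ R K) {a : W} (ha : ‖a‖ ≤ 1) :
    LipschitzOnWith K.toNNReal (fun z => S z a) (closedBall z₀ R) := by
  have hK := H.one_le
  refine LipschitzOnWith.of_dist_le_mul fun z hz w hw => ?_
  rw [dist_eq_norm, dist_eq_norm]
  calc ‖S z a - S w a‖ = ‖(S z - S w) a‖ := by simp
    _ ≤ ‖S z - S w‖ * ‖a‖ := ContinuousLinearMap.le_opNorm _ _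
    _ ≤ ‖S z - S w‖ * 1 := by gcongr
    _ ≤ K * ‖z - w‖ := by simpa using H.lipschitz w hw z hz
    _ = _ := by rw [Real.coe_toNNReal _ (by linarith)]

/-- Picard–Lindelöf: the speed is at most `K * ‖a‖ ≤ R / 4`, so in unit time a trajectory starting
within `R / 2` of the centre stays within `3 * R / 4`. -/
theorem exists_trajectory [CompleteSpace E] (H : CommutingFrame S S' T z₀ R K) {p : E} {a : W}
    (hp : ‖p - z₀‖ ≤ R / 2) (ha : ‖a‖ ≤ 1) (ha' : K * ‖a‖ ≤ R / 4) :
    ∃ α : ℝ → E, IsTrajectory S z₀ R a α ∧ α 0 = p ∧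
      ∀ t ∈ Icc (0 : ℝ) 1, ‖α t - p‖ ≤ K * ‖a‖ := by
  have hR := H.radius_pos
  have hK := H.one_le
  have hL : 0 ≤ K * ‖a‖ := by positivity
  have hsub : closedBall z₀ (3 * R / 4) ⊆ closedBall z₀ R := closedBall_subset_closedBall (by linarith)
  obtain ⟨r₁, hr₁⟩ : ∃ r : NNReal, (r : ℝ) = 3 * R / 4 := ⟨⟨3 * R / 4, by positivity⟩, rfl⟩
  obtain ⟨r₂, hr₂⟩ : ∃ r : NNReal, (r : ℝ) = R / 2 := ⟨⟨R / 2, by positivity⟩, rfl⟩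
  obtain ⟨L, hL'⟩ : ∃ r : NNReal, (r : ℝ) = K * ‖a‖ := ⟨⟨K * ‖a‖, hL⟩, rfl⟩
  rw [← hr₁] at hsub
  have hf : IsPicardLindelof (fun _ z => S z a) (tmin := 0) (tmax := 1) ⟨0, by simp⟩ z₀
      r₁ r₂ L K.toNNReal := by
    refine IsPicardLindelof.of_time_independent (fun z hz => ?_)
      ((H.lipschitzOnWith ha).mono hsub) ?_
    · rw [hL']
      exact (ContinuousLinearMap.le_opNorm _ _).trans
        (mul_le_mul_of_nonneg_right (H.norm_le z (hsub hz)) (norm_nonneg _))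
    · simp only [sub_zero, sub_self, zero_le_one, sup_of_le_left, mul_one]
      linarith
  have hx : p ∈ closedBall z₀ r₂ := mem_closedBall_iff_norm.2 (by rwa [hr₂])
  -- The fixed point of the Picard map carries, besides the equation, the confinement to the ball
  -- and the Lipschitz bound.
  obtain ⟨α, hα⟩ := ODE.FunSpace.exists_isFixedPt_next hf hx
  have h01 : (0 : ℝ) ∈ Icc (0 : ℝ) 1 := by simp
  have hα0 : α.compProj 0 = p := by
    have := ODE.FunSpace.next_apply₀ hf hx α
    rw [hα] at this
    rw [ODE.FunSpace.compProj_of_mem h01]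
    exact this
  refine ⟨α.compProj, ⟨fun t ht => ?_, fun t ht => ?_⟩, hα0, fun t ht => ?_⟩
  · apply ODE.hasDerivWithinAt_picard_Icc (left_mem_Icc.2 zero_le_one) hf.continuousOn_uncurry
      α.continuous_compProj.continuousOn (fun _ ht' ↦ α.compProj_mem_closedBall hf.mul_max_le)
      p ht |>.congr_of_mem _ ht
    intro t' ht'
    nth_rw 1 [← hα]
    rw [ODE.FunSpace.compProj_of_mem ht', ODE.FunSpace.next_apply]
  · rw [← hr₁]
    exact mem_closedBall_iff_norm.1 (α.compProj_mem_closedBall hf.mul_max_le)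
  · rw [← hα0, ODE.FunSpace.compProj_of_mem ht, ODE.FunSpace.compProj_of_mem h01]
    have h := α.lipschitzWith.dist_le_mul ⟨t, ht⟩ ⟨0, h01⟩
    rw [dist_eq_norm, hL'] at h
    refine h.trans ?_
    change K * ‖a‖ * |t - 0| ≤ K * ‖a‖
    rw [sub_zero, abs_of_nonneg ht.1]
    exact mul_le_of_le_one_right hL ht.2

theorem proj_trajectory (H : CommutingFrame S S' T z₀ R K) {a : W} {α : ℝ → E}
    (hα : IsTrajectory S z₀ R a α) : T (α 1) = T (α 0) + a := by
  have hd : ∀ t ∈ Icc (0 : ℝ) 1,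
      HasDerivWithinAt (fun t => T (α t) - t • a) 0 (Icc 0 1) t := by
    intro t ht
    have h1 := T.hasFDerivAt.comp_hasDerivWithinAt t (hα.hasDerivWithinAt t ht)
    rw [H.proj _ (hα.mem H.radius_pos ht)] at h1
    have h2 := h1.sub (((hasDerivAt_id t).smul_const a).hasDerivWithinAt (s := Icc 0 1))
    simp only [one_smul, sub_self] at h2
    exact h2
  have := constant_of_derivWithin_zero (fun t ht => (hd t ht).differentiableWithinAt)
    (fun t ht => (hd t (Ico_subset_Icc_self ht)).derivWithin
      (uniqueDiffOn_Icc zero_lt_one t (Ico_subset_Icc_self ht))) 1 (by simp)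
  simp only [one_smul, zero_smul, sub_zero] at this
  rw [← this]; abel

/-- Uniqueness backwards in time; it makes the label injective on each level set of `T`. -/
theorem trajectory_eq (H : CommutingFrame S S' T z₀ R K) {a : W} {α β : ℝ → E} (ha : ‖a‖ ≤ 1)
    (hα : IsTrajectory S z₀ R a α) (hβ : IsTrajectory S z₀ R a β) (h1 : α 1 = β 1) :
    α 0 = β 0 :=
  ODE_solution_unique_of_mem_Icc_left (v := fun _ z => S z a) (s := fun _ => closedBall z₀ R)
    (fun _ _ => H.lipschitzOnWith ha) hα.continuousOn (fun _ ht => hα.hasDerivWithinAt_Iic ht)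
    (fun _ ht => hα.mem H.radius_pos (Ioc_subset_Icc_self ht)) hβ.continuousOn
    (fun _ ht => hβ.hasDerivWithinAt_Iic ht)
    (fun _ ht => hβ.mem H.radius_pos (Ioc_subset_Icc_self ht)) h1 (by simp)

/-- The time one points of the trajectories in the directions `a` and `a - b`, from points
differing by approximately `S(α 0) b`, agree to first order. -/
theorem norm_endpoint_sub_le (H : CommutingFrame S S' T z₀ R K) {a b : W} {α β : ℝ → E}
    (hab : ‖a - b‖ ≤ 1) (hb : K * ‖b‖ ≤ R / 4)
    (hα : IsTrajectory S z₀ R a α) (hβ : IsTrajectory S z₀ R (a - b) β) :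
    ‖β 1 - α 1‖ ≤
      2 * K ^ 3 * Real.exp K * (‖β 0 - α 0 - S (α 0) b‖ + ‖b‖ ^ 2) := by
  have hR := H.radius_pos
  have hK := H.one_le
  -- `η` runs from `α 0 + S (α 0) b` to `α 1`. Because the frame commutes, it almost solves the
  -- equation of `β`.
  set η : ℝ → E := fun t => α t + (1 - t) • S (α t) b with hη
  set η' : ℝ → E := fun t => S (α t) a + ((1 - t) • S' (α t) (S (α t) a) b - S (α t) b) with hη'
  have hSb : ∀ t ∈ Icc (0 : ℝ) 1, ‖(1 - t) • S (α t) b‖ ≤ K * ‖b‖ := by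
    intro t ht
    rw [norm_smul, Real.norm_of_nonneg (by linarith [ht.2])]
    calc (1 - t) * ‖S (α t) b‖ ≤ 1 * (K * ‖b‖) := by
          have h1 : 1 - t ≤ 1 := by linarith [ht.1]
          have h2 : 0 ≤ 1 - t := by linarith [ht.2]
          have h3 := ContinuousLinearMap.le_of_opNorm_le (S (α t))
            (H.norm_le _ (hα.mem hR ht)) b
          gcongr
      _ = _ := one_mul _
  have hηd : ∀ t ∈ Icc (0 : ℝ) 1, HasDerivWithinAt η (η' t) (Icc 0 1) t := by
    intro t ht
    have hd := hα.hasDerivWithinAt t ht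
    have h1 := (H.hasFDerivAt _ (hα.mem hR ht)).comp_hasDerivWithinAt t hd
    have h2 := h1.clm_apply (hasDerivWithinAt_const t (Icc 0 1) b)
    have h3 := ((hasDerivAt_id t).const_sub 1).hasDerivWithinAt (s := Icc 0 1)
    have h4 := hd.add (h3.smul h2)
    convert! h4 using 1
    simp [hη', sub_eq_add_neg]
  have hηm : ∀ t ∈ Icc (0 : ℝ) 1, η t ∈ closedBall z₀ R := by
    intro t ht
    rw [mem_closedBall_iff_norm]
    calc ‖η t - z₀‖ = ‖(α t - z₀) + (1 - t) • S (α t) b‖ := by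
          rw [hη, sub_add_eq_add_sub]
      _ ≤ ‖α t - z₀‖ + ‖(1 - t) • S (α t) b‖ := norm_add_le _ _
      _ ≤ 3 * R / 4 + R / 4 := by
        gcongr
        · exact hα.dist_le t ht
        · exact (hSb t ht).trans hb
      _ = R := by ring
  have hηe : ∀ t ∈ Icc (0 : ℝ) 1,
      dist (η' t) (S (η t) (a - b)) ≤ 2 * K ^ 3 * ‖b‖ ^ 2 := by
    intro t ht
    have hm := hα.mem hR ht
    set u := S (α t) b with hu
    set rem := S (η t) - S (α t) - S' (α t) (η t - α t) with hrem
    have hηα : η t - α t = (1 - t) • u := by simp [hη, hu]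
    -- Commutativity cancels the terms that are linear in `b`; what is left is quadratic in `b`.
    have hid : η' t - S (η t) (a - b) = (1 - t) • S' (α t) u b - rem (a - b) := by
      have : S (η t) = S (α t) + S' (α t) ((1 - t) • u) + rem := by
        rw [hrem, hηα]; abel
      rw [this, hη']
      simp only [add_apply, map_smul, smul_apply, map_sub,
        hu, H.comm _ hm a b]
      abel
    have hrem' : ‖rem‖ ≤ K * (K * ‖b‖) ^ 2 := by
      refine (H.taylor _ hm _ (hηm t ht)).trans ?_
      rw [hηα]
      have := hSb t ht
      gcongr
    have hu' : ‖u‖ ≤ K * ‖b‖ := ContinuousLinearMap.le_of_opNorm_le _ (H.norm_le _ hm) b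
    have h1 : ‖(1 - t) • S' (α t) u b‖ ≤ K * (K * ‖b‖) * ‖b‖ := by
      rw [norm_smul, Real.norm_of_nonneg (by linarith [ht.2])]
      have h2 : ‖S' (α t) u b‖ ≤ K * (K * ‖b‖) * ‖b‖ := by
        refine ContinuousLinearMap.le_of_opNorm_le _ ?_ b
        refine (ContinuousLinearMap.le_of_opNorm_le _ (H.norm_deriv_le _ hm) u).trans ?_
        gcongr
      exact (mul_le_of_le_one_left (norm_nonneg _) (by linarith [ht.1])).trans h2
    have h2 : ‖rem (a - b)‖ ≤ K * (K * ‖b‖) ^ 2 :=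
      (ContinuousLinearMap.le_of_opNorm_le _ hrem' _).trans
        (mul_le_of_le_one_right (by positivity) hab)
    rw [dist_eq_norm, hid]
    have hK3 : K ^ 2 ≤ K ^ 3 := pow_le_pow_right₀ hK (by norm_num)
    calc _ ≤ K * (K * ‖b‖) * ‖b‖ + K * (K * ‖b‖) ^ 2 := (norm_sub_le _ _).trans (add_le_add h1 h2)
      _ = (K ^ 2 + K ^ 3) * ‖b‖ ^ 2 := by ring
      _ ≤ (K ^ 3 + K ^ 3) * ‖b‖ ^ 2 := by gcongr
      _ = _ := by ring
  -- Grönwall: `β` is an exact solution, `η` one up to the quadratic defect, and `η 1 = α 1`.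
  have key := dist_le_of_approx_trajectories_ODE_of_mem (K := K.toNNReal)
    (v := fun _ z => S z (a - b)) (s := fun _ => closedBall z₀ R) (a := 0) (b := 1)
    (f := β) (f' := fun t => S (β t) (a - b)) (g := η) (g' := η') (εf := 0)
    (εg := 2 * K ^ 3 * ‖b‖ ^ 2) (δ := ‖β 0 - α 0 - S (α 0) b‖)
    (fun _ _ => H.lipschitzOnWith hab) hβ.continuousOn
    (fun _ ht => hβ.hasDerivWithinAt_Ici ht) (fun _ _ => by simp)
    (fun _ ht => hβ.mem hR (Ico_subset_Icc_self ht))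
    (fun t ht => (hηd t ht).continuousWithinAt)
    (fun t ht => (hηd t (Ico_subset_Icc_self ht)).mono_of_mem_nhdsWithin
      (Icc_mem_nhdsGE_of_mem ht))
    (fun t ht => hηe t (Ico_subset_Icc_self ht)) (fun t ht => hηm t (Ico_subset_Icc_self ht))
    (by rw [dist_eq_norm, hη]; simp [sub_add_eq_sub_sub]) 1 (by simp)
  rw [dist_eq_norm, zero_add, Real.coe_toNNReal _ (by linarith),
    gronwallBound_of_K_ne_0 (by linarith)] at key
  have hη1 : η 1 = α 1 := by simp [hη]
  rw [hη1] at key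
  refine key.trans ?_
  simp only [sub_zero, mul_one]
  set δ := ‖β 0 - α 0 - S (α 0) b‖
  have hδ : 0 ≤ δ := norm_nonneg _
  have he : 0 < Real.exp K := Real.exp_pos K
  have hK3 : 1 ≤ K ^ 3 := one_le_pow₀ hK
  have e1 : δ * Real.exp K ≤ 2 * K ^ 3 * Real.exp K * δ := by
    have : 1 * (δ * Real.exp K) ≤ (2 * K ^ 3) * (δ * Real.exp K) := by
      gcongr; linarith
    linarith
  have e2 : 2 * K ^ 3 * ‖b‖ ^ 2 / K * (Real.exp K - 1) ≤ 2 * K ^ 3 * ‖b‖ ^ 2 * Real.exp K := by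
    have h0 : 0 ≤ 2 * K ^ 3 * ‖b‖ ^ 2 := by positivity
    have h1 : 0 ≤ Real.exp K - 1 := by linarith [Real.add_one_le_exp K]
    gcongr
    · exact div_le_self h0 hK
    · linarith
  linarith

/-- The first integral of a commuting frame: to first order it is invariant under displacements
along the frame, and two points where it agrees are joined by a trajectory. -/
theorem exists_label [CompleteSpace E] (H : CommutingFrame S S' T z₀ R K) :
    ∃ (h : E → E) (ρ C : ℝ), 0 < ρ ∧ ρ ≤ R ∧
      (∀ p ∈ ball z₀ ρ, ∀ p' ∈ ball z₀ ρ,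
        ‖h p' - h p‖ ≤ C * (‖p' - p - S p (T (p' - p))‖ + ‖T (p' - p)‖ ^ 2)) ∧
      (∀ p ∈ ball z₀ ρ, ∀ p' ∈ ball z₀ ρ, h p' = h p → ∃ α : ℝ → E, α 0 = p ∧ α 1 = p' ∧
        ∀ t ∈ Icc (0 : ℝ) 1, HasDerivWithinAt α (S (α t) (T (p' - p))) (Icc 0 1) t ∧
          ‖α t - p‖ ≤ K * ‖T (p' - p)‖) ∧
      (∀ p ∈ ball z₀ ρ, ∀ p' ∈ ball z₀ ρ, h p' = h p →
        ‖p' - p - S p (T (p' - p))‖ ≤ K ^ 2 * ‖T (p' - p)‖ ^ 2) := by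
  have hR := H.radius_pos
  have hK := H.one_le
  have hK0 : 0 < K := by linarith
  set N := ‖T‖ + 1 with hN
  have hN0 : 1 ≤ N := by have := norm_nonneg T; linarith
  have hT : ∀ z, ‖T z‖ ≤ N * ‖z‖ := fun z =>
    (T.le_opNorm z).trans (mul_le_mul_of_nonneg_right (by linarith) (norm_nonneg z))
  -- the bound on the directions, and the radii of two concentric balls
  set A := min 1 (R / (4 * K)) with hA
  have hA0 : 0 < A := by positivity
  have hA1 : A ≤ 1 := min_le_left _ _
  have hAR : K * A ≤ R / 4 := by
    calc K * A ≤ K * (R / (4 * K)) := by gcongr; exact min_le_right _ _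
      _ = R / 4 := by field_simp
  have hsmall : ∀ a : W, ‖a‖ ≤ A → K * ‖a‖ ≤ R / 4 := fun a ha =>
    (mul_le_mul_of_nonneg_left ha hK0.le).trans hAR
  set ρ₁ := min (R / 2) (A / (2 * N)) with hρ₁
  have hρ₁0 : 0 < ρ₁ := by positivity
  have hρ₁R : ρ₁ ≤ R / 2 := min_le_left _ _
  have hρ₁A : 2 * N * ρ₁ ≤ A := by
    calc 2 * N * ρ₁ ≤ 2 * N * (A / (2 * N)) := by gcongr; exact min_le_right _ _
      _ = A := by field_simp
  -- A trajectory in the direction `T (p' - p)`, with `p` and `p'` in the ball of radius `ρ`, moves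
  -- by at most `2 * K * N * ρ = ρ₁ / 2`. It stays in the ball of radius `ρ₁`, on which the label is
  -- controlled.
  set ρ := ρ₁ / (4 * K * N) with hρ
  have hρ0 : 0 < ρ := by positivity
  have hρe : ρ * (4 * (K * N)) = ρ₁ := by rw [hρ]; field_simp
  have hKN : 1 ≤ K * N := one_le_mul_of_one_le_of_one_le hK hN0
  have hρle : ρ ≤ ρ₁ := by nlinarith
  have hTz : ∀ p, ‖p - z₀‖ ≤ ρ₁ → ‖T z₀ - T p‖ ≤ A := by
    intro p hp
    rw [← map_sub]
    refine (hT _).trans ?_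
    rw [norm_sub_rev]
    nlinarith
  have hTT : ∀ p p', ‖p - z₀‖ ≤ ρ₁ → ‖p' - z₀‖ ≤ ρ₁ → ‖T (p' - p)‖ ≤ A := by
    intro p p' hp hp'
    refine (hT _).trans ?_
    have : ‖p' - p‖ ≤ ρ₁ + ρ₁ := by
      calc ‖p' - p‖ = ‖(p' - z₀) - (p - z₀)‖ := by congr 1; abel
        _ ≤ _ := (norm_sub_le _ _).trans (add_le_add hp' hp)
    calc N * ‖p' - p‖ ≤ N * (ρ₁ + ρ₁) := by gcongr
      _ ≤ A := by linarith
  -- The trajectory in the direction `T z₀ - T p` reaches the slice `T = T z₀` at time one; this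
  -- endpoint is the label of `p`.
  have hex : ∀ p : E, ∃ α : ℝ → E, ‖p - z₀‖ ≤ ρ₁ →
      IsTrajectory S z₀ R (T z₀ - T p) α ∧ α 0 = p := by
    intro p
    by_cases hp : ‖p - z₀‖ ≤ ρ₁
    · obtain ⟨α, hα, h0, -⟩ := H.exists_trajectory (hp.trans hρ₁R) ((hTz p hp).trans hA1)
        (hsmall _ (hTz p hp))
      exact ⟨α, fun _ => ⟨hα, h0⟩⟩
    · exact ⟨fun _ => 0, fun h => absurd h hp⟩
  choose γ hγ using hex
  set C := 2 * K ^ 3 * Real.exp K with hC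
  have hest : ∀ p, ‖p - z₀‖ ≤ ρ₁ → ∀ p', ‖p' - z₀‖ ≤ ρ₁ →
      ‖γ p' 1 - γ p 1‖ ≤ C * (‖p' - p - S p (T (p' - p))‖ + ‖T (p' - p)‖ ^ 2) := by
    intro p hp p' hp'
    obtain ⟨h1, h10⟩ := hγ p hp
    obtain ⟨h2, h20⟩ := hγ p' hp'
    -- This is the form `a - b` of `norm_endpoint_sub_le`, with `b = T (p' - p)`.
    have hsub : T z₀ - T p' = (T z₀ - T p) - T (p' - p) := by rw [map_sub]; abel
    have hle := (hTz p' hp').trans hA1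
    rw [hsub] at h2 hle
    have := H.norm_endpoint_sub_le hle (hsmall _ (hTT p p' hp hp')) h1 h2
    rwa [h10, h20] at this
  have hjoin : ∀ p ∈ ball z₀ ρ, ∀ p' ∈ ball z₀ ρ, γ p' 1 = γ p 1 → ∃ α : ℝ → E, α 0 = p ∧
      α 1 = p' ∧ ∀ t ∈ Icc (0 : ℝ) 1, HasDerivWithinAt α (S (α t) (T (p' - p))) (Icc 0 1) t ∧
        ‖α t - p‖ ≤ K * ‖T (p' - p)‖ ∧ ‖α t - z₀‖ ≤ ρ₁ := by
    intro p hp p' hp' heq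
    rw [mem_ball_iff_norm] at hp hp'
    have hp1 : ‖p - z₀‖ ≤ ρ₁ := by linarith
    have hp1' : ‖p' - z₀‖ ≤ ρ₁ := by linarith
    have hA' := hTT p p' hp1 hp1'
    obtain ⟨α, hα, h0, hαp⟩ := H.exists_trajectory (hp1.trans hρ₁R) (hA'.trans hA1)
      (hsmall _ hA')
    have hTρ : K * ‖T (p' - p)‖ ≤ K * (N * (2 * ρ)) := by
      have : ‖p' - p‖ ≤ 2 * ρ := by
        calc ‖p' - p‖ = ‖(p' - z₀) - (p - z₀)‖ := by congr 1; abel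
          _ ≤ ρ + ρ := (norm_sub_le _ _).trans (add_le_add hp'.le hp.le)
          _ = 2 * ρ := by ring
      have := hT (p' - p)
      gcongr
      nlinarith
    have hnear : ∀ t ∈ Icc (0 : ℝ) 1, ‖α t - z₀‖ ≤ ρ₁ := by
      intro t ht
      calc ‖α t - z₀‖ = ‖(α t - p) + (p - z₀)‖ := by congr 1; abel
        _ ≤ K * (N * (2 * ρ)) + ρ :=
          (norm_add_le _ _).trans (add_le_add ((hαp t ht).trans hTρ) hp.le)
        _ ≤ ρ₁ := by nlinarith
    -- `α 1` and `p'` have the same image under `T` and the same label. Their trajectories to the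
    -- slice then have equal directions and equal ends, hence equal starting points.
    suffices h : α 1 = p' from ⟨α, h0, h, fun t ht => ⟨hα.hasDerivWithinAt t ht, hαp t ht, hnear t ht⟩⟩
    have hT1 : T (α 1) = T p' := by
      rw [H.proj_trajectory hα, h0, map_sub]; abel
    -- the label is constant along `α`
    have hconst : γ (α 1) 1 = γ (α 0) 1 := by
      have hd : ∀ t ∈ Icc (0 : ℝ) 1,
          HasDerivWithinAt (fun t => γ (α t) 1) 0 (Icc 0 1) t := by
        intro t ht
        have hm := hα.mem hR ht
        refine hasDerivWithinAt_zero_of_first_order_invariant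
          (h := fun z => γ z 1) (N := closedBall z₀ ρ₁)
          (fun z hz => hest _ (hnear t ht) z (mem_closedBall_iff_norm.1 hz))
          (hα.hasDerivWithinAt t ht) (by rw [H.proj _ hm]) ?_
        filter_upwards [self_mem_nhdsWithin] with x hx
        exact mem_closedBall_iff_norm.2 (hnear x hx)
      exact constant_of_derivWithin_zero (f := fun t => γ (α t) 1)
        (fun t ht => (hd t ht).differentiableWithinAt)
        (fun t ht => (hd t (Ico_subset_Icc_self ht)).derivWithin
          (uniqueDiffOn_Icc zero_lt_one t (Ico_subset_Icc_self ht))) 1 (by simp)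
    rw [h0] at hconst
    obtain ⟨h1, h10⟩ := hγ _ (hnear 1 (by simp))
    obtain ⟨h2, h20⟩ := hγ p' hp1'
    rw [hT1] at h1
    have := H.trajectory_eq ((hTz p' hp1').trans hA1) h1 h2 (by rw [hconst]; exact heq.symm)
    rw [h10, h20] at this
    exact this
  refine ⟨fun p => γ p 1, ρ, C, hρ0, by linarith, ?_, ?_, ?_⟩
  · intro p hp p' hp'
    rw [mem_ball_iff_norm] at hp hp'
    exact hest p (by linarith) p' (by linarith)
  · intro p hp p' hp' heq
    obtain ⟨α, h0, h1, hα⟩ := hjoin p hp p' hp' heq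
    exact ⟨α, h0, h1, fun t ht => ⟨(hα t ht).1, (hα t ht).2.1⟩⟩
  · intro p hp p' hp' heq
    obtain ⟨α, h0, h1, hα⟩ := hjoin p hp p' hp' heq
    set a := T (p' - p)
    have hmem : ∀ z, ‖z - z₀‖ ≤ ρ₁ → z ∈ closedBall z₀ R := fun z hz =>
      mem_closedBall_iff_norm.2 (by linarith)
    have hp1 : p ∈ closedBall z₀ R := by
      rw [mem_ball_iff_norm] at hp
      exact hmem p (by linarith)
    -- The joining trajectory is compared with the straight line of velocity `S p a`. The velocities
    -- differ by at most `K ^ 2 * ‖a‖ ^ 2`, as `S` is Lipschitz and the trajectory stays within `K *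
    -- ‖a‖` of `p`.
    have hd : ∀ t ∈ Icc (0 : ℝ) 1,
        HasDerivWithinAt (fun t => α t - t • S p a) (S (α t) a - S p a) (Icc 0 1) t := by
      intro t ht
      have h2 := (hα t ht).1.sub
        (((hasDerivAt_id t).smul_const (S p a)).hasDerivWithinAt (s := Icc 0 1))
      simp only [one_smul] at h2
      exact h2
    have := norm_image_sub_le_of_norm_deriv_le_segment' hd (C := K ^ 2 * ‖a‖ ^ 2)
      (fun t ht => ?_) 1 (by simp)
    · simp only [h0, h1, one_smul, zero_smul, sub_zero, mul_one] at this
      rwa [sub_right_comm] at this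
    · obtain ⟨-, h2, h3⟩ := hα t (Ico_subset_Icc_self ht)
      calc ‖S (α t) a - S p a‖ = ‖(S (α t) - S p) a‖ := by simp
        _ ≤ K * (K * ‖a‖) * ‖a‖ := by
          refine ContinuousLinearMap.le_of_opNorm_le _ ((H.lipschitz p hp1 _ (hmem _ h3)).trans ?_) a
          gcongr
        _ = _ := by ring

end CommutingFrame
end Frobenius

/-! ### The local Frobenius theorem in a normed space -/

section Frobenius

open Metric

variable {E W : Type*} [NormedAddCommGroup E] [NormedSpace ℝ E]
  [NormedAddCommGroup W] [NormedSpace ℝ W]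

/-- A frame which is normalized by `T (S z a) = a` and spans an involutive distribution commutes. -/
theorem fderiv_comm_of_involutive {Ω : Set E} (hΩ : IsOpen Ω) {S : E → W →L[ℝ] E} {T : E →L[ℝ] W}
    (hS : ContDiffOn ℝ ∞ S Ω) (hT : ∀ z ∈ Ω, ∀ a, T (S z a) = a)
    (hinv : ∀ X Y : E → E, ContDiffOn ℝ ∞ X Ω → ContDiffOn ℝ ∞ Y Ω →
      (∀ z ∈ Ω, X z ∈ (S z).range) → (∀ z ∈ Ω, Y z ∈ (S z).range) →
      ∀ z ∈ Ω, VectorField.lieBracket ℝ X Y z ∈ (S z).range)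
    {z : E} (hz : z ∈ Ω) (a b : W) : fderiv ℝ S z (S z a) b = fderiv ℝ S z (S z b) a := by
  have hd : DifferentiableAt ℝ S z :=
    (hS.contDiffAt (hΩ.mem_nhds hz)).differentiableAt (by simp)
  have hX : ∀ c : W, ContDiffOn ℝ ∞ (fun z => S z c) Ω := fun c => hS.clm_apply contDiffOn_const
  have hfX : ∀ c u, fderiv ℝ (fun z => S z c) z u = fderiv ℝ S z u c := by
    intro c u
    rw [fderiv_clm_apply hd (differentiableAt_const c)]
    simp
  -- By involutivity the bracket is `S z w` for some `w`. Since `T (S z c) = c` is constant in `z`,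
  -- `T` kills the bracket, so `w = T (S z w) = 0`.
  obtain ⟨w, hw⟩ := hinv _ _ (hX a) (hX b) (fun z _ => ⟨a, rfl⟩) (fun z _ => ⟨b, rfl⟩) z hz
  have hT0 : ∀ c u, T (fderiv ℝ S z u c) = 0 := by
    intro c u
    rw [← hfX]
    have h1 : HasFDerivAt (fun z => T (S z c)) (T.comp (fderiv ℝ (fun z => S z c) z)) z :=
      T.hasFDerivAt.comp z (hd.clm_apply (differentiableAt_const c)).hasFDerivAt
    have h2 : (fun z => T (S z c)) =ᶠ[𝓝 z] fun _ => c := by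
      filter_upwards [hΩ.mem_nhds hz] with y hy using hT y hy c
    have h3 := h1.unique ((hasFDerivAt_const c z).congr_of_eventuallyEq h2)
    exact congrArg (fun L : E →L[ℝ] W => L u) h3
  have hbr : VectorField.lieBracket ℝ (fun z => S z a) (fun z => S z b) z =
      fderiv ℝ S z (S z a) b - fderiv ℝ S z (S z b) a := by
    rw [VectorField.lieBracket, hfX, hfX]
  have hw' : S z w = fderiv ℝ S z (S z a) b - fderiv ℝ S z (S z b) a := hw.trans hbr
  have : w = 0 := by
    rw [← hT z hz w, hw', map_sub, hT0, hT0, sub_zero]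
  rw [this, map_zero] at hw'
  exact (sub_eq_zero.1 hw'.symm)

/-- A frame can be normalized, near a given point. -/
theorem exists_normalized_frame [FiniteDimensional ℝ E] [FiniteDimensional ℝ W] {Ω : Set E}
    (hΩ : IsOpen Ω) {z₀ : E} (hz₀ : z₀ ∈ Ω)
    {S₀ : E → W →L[ℝ] E} (hS₀ : ContDiffOn ℝ ∞ S₀ Ω) (hinj : Function.Injective (S₀ z₀)) :
    ∃ (S : E → W →L[ℝ] E) (T : E →L[ℝ] W) (Ω' : Set E), IsOpen Ω' ∧ z₀ ∈ Ω' ∧ Ω' ⊆ Ω ∧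
      ContDiffOn ℝ ∞ S Ω' ∧ (∀ z ∈ Ω', ∀ a, T (S z a) = a) ∧
      ∀ z ∈ Ω', (S z).range = (S₀ z).range := by
  have : CompleteSpace W := FiniteDimensional.complete ℝ W
  -- With `T` a left inverse of `S₀ z₀`, the map `M z = T ∘ S₀ z` is the identity at `z₀` and so
  -- invertible nearby; the normalized frame is `S₀ z ∘ (M z)⁻¹`.
  obtain ⟨T₀, hT₀⟩ := (S₀ z₀).toLinearMap.exists_leftInverse_of_injective
    (LinearMap.ker_eq_bot.2 hinj)
  let T : E →L[ℝ] W := LinearMap.toContinuousLinearMap T₀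
  let M : E → W →L[ℝ] W := fun z => T.comp (S₀ z)
  have hM0 : M z₀ = ContinuousLinearMap.id ℝ W := by
    ext a
    exact congrArg (fun L : W →ₗ[ℝ] W => L a) hT₀
  have hM : ContDiffOn ℝ ∞ M Ω := contDiffOn_const.clm_comp hS₀
  have hev : ∀ᶠ z in 𝓝 z₀, (M z).IsInvertible := by
    have h1 := (hM.contDiffAt (hΩ.mem_nhds hz₀)).continuousAt
    have h2 := ContinuousLinearEquiv.nhds (ContinuousLinearEquiv.refl ℝ W)
    have h3 : M z₀ = (ContinuousLinearEquiv.refl ℝ W : W →L[ℝ] W) := hM0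
    rw [← h3] at h2
    filter_upwards [h1 h2] with z hz
    obtain ⟨e, he⟩ := hz
    exact ⟨e, he⟩
  obtain ⟨Ω', hΩ's, hΩ', hz₀'⟩ := _root_.mem_nhds_iff.1 (hev.and (hΩ.mem_nhds hz₀))
  refine ⟨fun z => (S₀ z).comp (M z).inverse, T, Ω', hΩ', hz₀', fun z hz => (hΩ's hz).2, ?_, ?_, ?_⟩
  · intro z hz
    refine ContDiffAt.contDiffWithinAt ?_
    have h1 := hM.contDiffAt (hΩ.mem_nhds (hΩ's hz).2)
    exact (hS₀.contDiffAt (hΩ.mem_nhds (hΩ's hz).2)).clm_comp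
      (ContDiffAt.comp z (hΩ's hz).1.contDiffAt_map_inverse h1)
  · exact fun z hz a => (hΩ's hz).1.self_apply_inverse a
  · intro z hz
    have hs := (hΩ's hz).1.inverse.surjective
    apply le_antisymm
    · rintro _ ⟨a, rfl⟩
      exact ⟨(M z).inverse a, rfl⟩
    · rintro _ ⟨a, rfl⟩
      obtain ⟨b, rfl⟩ := hs a
      exact ⟨b, rfl⟩

/-- Smooth, normalized, commuting frames satisfy uniform bounds on small balls. -/
theorem exists_commutingFrame {Ω : Set E} (hΩ : IsOpen Ω) {z₀ : E} (hz₀ : z₀ ∈ Ω)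
    {S : E → W →L[ℝ] E} {T : E →L[ℝ] W} (hS : ContDiffOn ℝ ∞ S Ω)
    (hT : ∀ z ∈ Ω, ∀ a, T (S z a) = a)
    (hcomm : ∀ z ∈ Ω, ∀ a b, fderiv ℝ S z (S z a) b = fderiv ℝ S z (S z b) a) :
    ∃ R K, CommutingFrame S (fderiv ℝ S) T z₀ R K ∧ closedBall z₀ R ⊆ Ω := by
  have hS0 := hS.contDiffAt (hΩ.mem_nhds hz₀)
  have hS1 : ContDiffAt ℝ 1 (fderiv ℝ S) z₀ := hS0.fderiv_right (m := 1) (by norm_num; exact WithTop.coe_le_coe.2 le_top)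
  obtain ⟨K₁, t₁, ht₁, hK₁⟩ := (hS0.of_le (m := 1) (by norm_num)).exists_lipschitzOnWith
  obtain ⟨K₂, t₂, ht₂, hK₂⟩ := hS1.exists_lipschitzOnWith
  have hb1 : ∀ᶠ z in 𝓝 z₀, ‖S z‖ ≤ ‖S z₀‖ + 1 :=
    hS0.continuousAt.norm.eventually_le_const (lt_add_one ‖S z₀‖)
  obtain ⟨R, hR, hsub⟩ := Metric.nhds_basis_closedBall.mem_iff.1
    (Filter.inter_mem (Filter.inter_mem ht₁ ht₂) (Filter.inter_mem hb1 (hΩ.mem_nhds hz₀)))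
  -- The summands bound, in turn, the Lipschitz constants of `S` and of its derivative, the norm of
  -- `S` (and give `1 ≤ K`), and the norm of the derivative.
  set K : ℝ := K₁ + K₂ + (‖S z₀‖ + 1) + (‖fderiv ℝ S z₀‖ + K₂ * R) with hK
  have n1 := norm_nonneg (S z₀)
  have n2 := norm_nonneg (fderiv ℝ S z₀)
  have n3 : (0 : ℝ) ≤ K₁ := K₁.2
  have n4 : (0 : ℝ) ≤ K₂ := K₂.2
  have n5 : 0 ≤ K₂ * R := by positivity
  have hd : ∀ z ∈ closedBall z₀ R, HasFDerivAt S (fderiv ℝ S z) z := fun z hz =>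
    ((hS.contDiffAt (hΩ.mem_nhds (hsub hz).2.2)).differentiableAt (by simp)).hasFDerivAt
  refine ⟨R, K, ⟨hR, by linarith, hd, fun z hz => ?_, fun z hz => ?_, fun z hz w hw => ?_,
    fun z hz w hw => ?_, fun z hz => hcomm z (hsub hz).2.2, fun z hz => hT z (hsub hz).2.2⟩,
    fun z hz => (hsub hz).2.2⟩
  · have h1 : ‖S z‖ ≤ ‖S z₀‖ + 1 := (hsub hz).2.1
    linarith
  · have h1 := hK₂.norm_sub_le (hsub hz).1.2 (mem_of_mem_nhds ht₂)
    have h2 : K₂ * ‖z - z₀‖ ≤ K₂ * R :=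
      mul_le_mul_of_nonneg_left (mem_closedBall_iff_norm.1 hz) n4
    have h3 := norm_le_norm_sub_add (fderiv ℝ S z) (fderiv ℝ S z₀)
    linarith
  · refine (hK₁.norm_sub_le (hsub hw).1.1 (hsub hz).1.1).trans ?_
    gcongr
    linarith
  · have hseg : segment ℝ z w ⊆ closedBall z₀ R := (convex_closedBall z₀ R).segment_subset hz hw
    have := Convex.norm_image_sub_le_of_norm_hasFDerivWithin_le' (f := S) (f' := fderiv ℝ S)
      (s := segment ℝ z w) (φ := fderiv ℝ S z) (C := K * ‖w - z‖)
      (fun x hx => (hd x (hseg hx)).hasFDerivWithinAt) (fun x hx => ?_) (convex_segment z w)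
      (left_mem_segment ℝ z w) (right_mem_segment ℝ z w)
    · rwa [mul_assoc, ← sq] at this
    · refine (hK₂.norm_sub_le (hsub (hseg hx)).1.2 (hsub hz).1.2).trans ?_
      have : ‖x - z‖ ≤ ‖w - z‖ := norm_sub_le_of_mem_segment hx
      gcongr
      linarith

/-- The local Frobenius theorem in a normed space, in terms of a first integral `h`. -/
theorem exists_firstIntegral [FiniteDimensional ℝ E] [FiniteDimensional ℝ W]
    {G : E → Submodule ℝ E} {Ω : Set E} (hΩ : IsOpen Ω) {z₀ : E} (hz₀ : z₀ ∈ Ω)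
    {S₀ : E → W →L[ℝ] E} (hS₀ : ContDiffOn ℝ ∞ S₀ Ω) (hinj : Function.Injective (S₀ z₀))
    (hG : ∀ z ∈ Ω, G z = (S₀ z).range)
    (hinv : ∀ U ⊆ Ω, IsOpen U → ∀ X Y : E → E, ContDiffOn ℝ ∞ X U → ContDiffOn ℝ ∞ Y U →
      (∀ z ∈ U, X z ∈ G z) → (∀ z ∈ U, Y z ∈ G z) →
      ∀ z ∈ U, VectorField.lieBracket ℝ X Y z ∈ G z) :
    ∃ (h : E → E) (B : Set E), IsOpen B ∧ z₀ ∈ B ∧ B ⊆ Ω ∧ ContinuousOn h B ∧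
      (∀ (c : ℝ → E) (v : E) (s : Set ℝ) (t : ℝ), HasDerivWithinAt c v s t → c t ∈ B →
        v ∈ G (c t) → HasDerivWithinAt (fun x => h (c x)) 0 s t) ∧
      (∀ p ∈ B, ∀ U ∈ 𝓝 p, ∃ N ∈ 𝓝 p, ∀ p' ∈ N, h p' = h p →
        ∃ α : ℝ → E, α 0 = p ∧ α 1 = p' ∧ ∀ t ∈ Icc (0 : ℝ) 1, α t ∈ U ∧
          ∃ v ∈ G (α t), HasDerivWithinAt α v (Icc 0 1) t) ∧
      (∀ (c : ℝ → E) (v : E) (t : ℝ), HasDerivAt c v t → c t ∈ B →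
        (∀ᶠ x in 𝓝 t, h (c x) = h (c t)) → v ∈ G (c t)) := by
  have : CompleteSpace E := FiniteDimensional.complete ℝ E
  obtain ⟨S, T, Ω', hΩ', hz₀', hsub, hS, hT, hrange⟩ := exists_normalized_frame hΩ hz₀ hS₀ hinj
  have hG' : ∀ z ∈ Ω', G z = (S z).range := fun z hz => (hG z (hsub hz)).trans (hrange z hz).symm
  obtain ⟨R, K, H, hR⟩ := exists_commutingFrame hΩ' hz₀' hS hT fun z hz a b =>
    fderiv_comm_of_involutive hΩ' hS hT (fun X Y hX hY hX' hY' z hz => by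
      rw [← hG' z hz]
      exact hinv Ω' hsub hΩ' X Y hX hY (fun z hz => by rw [hG' z hz]; exact hX' z hz)
        (fun z hz => by rw [hG' z hz]; exact hY' z hz) z hz) hz a b
  obtain ⟨h, ρ, C, hρ, hρR, h1, h2, h3⟩ := H.exists_label
  have hBΩ : ball z₀ ρ ⊆ Ω' := (ball_subset_closedBall.trans (closedBall_subset_closedBall hρR)).trans hR
  have hrg : ∀ z ∈ Ω', ∀ v ∈ G z, S z (T v) = v := by
    intro z hz v hv
    rw [hG' z hz] at hv
    obtain ⟨a, rfl⟩ := hv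
    exact congrArg (S z) (hT z hz a)
  refine ⟨h, ball z₀ ρ, isOpen_ball, mem_ball_self hρ, hBΩ.trans hsub, ?_, ?_, ?_, ?_⟩
  · intro p hp
    refine ContinuousAt.continuousWithinAt ?_
    rw [ContinuousAt, tendsto_iff_norm_sub_tendsto_zero]
    have hcont : Continuous fun p' => C * (‖p' - p - S p (T (p' - p))‖ + ‖T (p' - p)‖ ^ 2) := by
      fun_prop
    have h0 := hcont.tendsto p
    simp only [sub_self, map_zero, norm_zero, ne_eq, OfNat.ofNat_ne_zero, not_false_eq_true,
      zero_pow, add_zero, mul_zero] at h0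
    refine squeeze_zero' (Filter.Eventually.of_forall fun _ => norm_nonneg _) ?_ h0
    filter_upwards [isOpen_ball.mem_nhds hp] with p' hp' using h1 p hp p' hp'
  · intro c v s t hc ht hv
    exact hasDerivWithinAt_zero_of_first_order_invariant (N := ball z₀ ρ) (P := S (c t))
      (fun z hz => h1 _ ht z hz) hc (hrg _ (hBΩ ht) v hv)
      (hc.continuousWithinAt.eventually (isOpen_ball.mem_nhds ht))
  · intro p hp U hU
    obtain ⟨ε, hε, hεU⟩ := Metric.mem_nhds_iff.1 (Filter.inter_mem hU (hΩ'.mem_nhds (hBΩ hp)))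
    have hcont : Continuous fun p' => K * ‖T (p' - p)‖ := by fun_prop
    have h0 : ∀ᶠ p' in 𝓝 p, K * ‖T (p' - p)‖ < ε := by
      refine (hcont.tendsto p).eventually_lt_const ?_
      simpa using hε
    refine ⟨_, Filter.inter_mem h0 (isOpen_ball.mem_nhds hp), ?_⟩
    rintro p' ⟨hp'ε, hp'⟩ heq
    obtain ⟨α, hα0, hα1, hα⟩ := h2 p hp p' hp' heq
    refine ⟨α, hα0, hα1, fun t ht => ?_⟩
    have hm := hεU (mem_ball_iff_norm.2 ((hα t ht).2.trans_lt hp'ε))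
    refine ⟨hm.1, _, ?_, (hα t ht).1⟩
    rw [hG' _ hm.2]
    exact ⟨_, rfl⟩
  · intro c v t hc ht hev
    -- `L` vanishes exactly on the range of `S (c t)`. On a level set of `h` the deviation of `c x -
    -- c t` from this range is quadratic, so `L ∘ c` has derivative zero at `t`.
    let L : E →L[ℝ] E := ContinuousLinearMap.id ℝ E - (S (c t)).comp T
    suffices hL : L v = 0 by
      rw [hG' _ (hBΩ ht)]
      exact ⟨T v, (sub_eq_zero.1 hL).symm⟩
    have hd : HasDerivAt (fun x => L (c x)) (L v) t := L.hasFDerivAt.comp_hasDerivAt t hc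
    refine hd.unique ?_
    rw [hasDerivAt_iff_isLittleO]
    simp only [smul_zero, sub_zero]
    have hO : (fun x => L (c x) - L (c t)) =O[𝓝 t] fun x => ‖x - t‖ ^ 2 := by
      have h4 : (fun x => L (c x) - L (c t)) =O[𝓝 t] fun x => ‖T (c x - c t)‖ ^ 2 := by
        refine Asymptotics.IsBigO.of_bound (K ^ 2) ?_
        filter_upwards [hev, hc.continuousAt.eventually (isOpen_ball.mem_nhds ht)] with x hx hx'
        rw [norm_pow, norm_norm]
        convert! h3 _ ht _ hx' hx using 2
        simp [L]
        abel
      have h5 : (fun x => T (c x - c t)) =O[𝓝 t] fun x => x - t :=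
        (T.isBigO_comp _ _).trans hc.differentiableAt.isBigO_sub
      exact h4.trans (h5.norm_norm.pow 2)
    refine hO.trans_isLittleO ?_
    have h6 : (fun x : ℝ => x - t) =o[𝓝 t] fun _ => (1 : ℝ) := by
      rw [Asymptotics.isLittleO_one_iff]
      have : Continuous fun x : ℝ => x - t := by fun_prop
      simpa using this.tendsto t
    simpa [sq] using h6.mul_isBigO (Asymptotics.isBigO_refl (fun x : ℝ => x - t) _)

end Frobenius

/-! ### Tangent maps of charts -/

section Charts

variable {m : ℕ} {M : Type*} [TopologicalSpace M] [ChartedSpace (EuclideanSpace ℝ (Fin m)) M]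

/-- The tangent map at `x` of the chart at `x₀`. -/
def chartD (x₀ x : M) : TangentSpace (𝓡 m) x →L[ℝ] EuclideanSpace ℝ (Fin m) :=
  mfderiv (𝓡 m) 𝓘(ℝ, EuclideanSpace ℝ (Fin m)) (extChartAt (𝓡 m) x₀) x

/-- The tangent map at `z` of the inverse of the chart at `x₀`. -/
def chartSymmD (x₀ : M) (z : EuclideanSpace ℝ (Fin m)) :
    EuclideanSpace ℝ (Fin m) →L[ℝ] TangentSpace (𝓡 m) ((extChartAt (𝓡 m) x₀).symm z) :=
  mfderiv 𝓘(ℝ, EuclideanSpace ℝ (Fin m)) (𝓡 m) (extChartAt (𝓡 m) x₀).symm z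

variable [IsManifold (𝓡 m) ∞ M] {x₀ x : M} {z : EuclideanSpace ℝ (Fin m)}

theorem chartD_chartSymmD (hz : z ∈ (extChartAt (𝓡 m) x₀).target) (u : EuclideanSpace ℝ (Fin m)) :
    chartD x₀ ((extChartAt (𝓡 m) x₀).symm z) (chartSymmD x₀ z u) = u := by
  have h := mfderiv_extChartAt_comp_mfderivWithin_extChartAt_symm hz
  rw [ModelWithCorners.range_eq_univ, mfderivWithin_univ] at h
  exact congrArg (fun L : EuclideanSpace ℝ (Fin m) →L[ℝ] EuclideanSpace ℝ (Fin m) => L u) h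

theorem chartSymmD_chartD (hx : x ∈ (extChartAt (𝓡 m) x₀).source) (u : TangentSpace (𝓡 m) x) :
    chartSymmD x₀ (extChartAt (𝓡 m) x₀ x) (chartD x₀ x u) = u := by
  have h := mfderivWithin_extChartAt_symm_comp_mfderiv_extChartAt' (I := 𝓡 m) hx
  rw [ModelWithCorners.range_eq_univ, mfderivWithin_univ] at h
  exact congrArg (fun L : EuclideanSpace ℝ (Fin m) →L[ℝ] EuclideanSpace ℝ (Fin m) => L u) h

theorem isInvertible_chartD (hx : x ∈ (extChartAt (𝓡 m) x₀).source) :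
    (chartD (m := m) x₀ x).IsInvertible :=
  isInvertible_mfderiv_extChartAt hx

theorem chartD_self : chartD (m := m) x₀ x₀ = ContinuousLinearMap.id ℝ (EuclideanSpace ℝ (Fin m)) :=
  mfderiv_extChartAt_self (I := 𝓡 m)

theorem hasMFDerivAt_chart (hx : x ∈ (extChartAt (𝓡 m) x₀).source) :
    HasMFDerivAt (𝓡 m) 𝓘(ℝ, EuclideanSpace ℝ (Fin m)) (extChartAt (𝓡 m) x₀) x (chartD x₀ x) :=
  (mdifferentiableAt_extChartAt (by rwa [extChartAt_source] at hx)).hasMFDerivAt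

theorem contMDiffAt_chart_symm (hz : z ∈ (extChartAt (𝓡 m) x₀).target) :
    ContMDiffAt 𝓘(ℝ, EuclideanSpace ℝ (Fin m)) (𝓡 m) ∞ (extChartAt (𝓡 m) x₀).symm z :=
  (contMDiffOn_extChartAt_symm x₀).contMDiffAt ((isOpen_extChartAt_target x₀).mem_nhds hz)

theorem contMDiffAt_chart (hx : x ∈ (extChartAt (𝓡 m) x₀).source) :
    ContMDiffAt (𝓡 m) 𝓘(ℝ, EuclideanSpace ℝ (Fin m)) ∞ (extChartAt (𝓡 m) x₀) x :=
  contMDiffAt_extChartAt' (by rwa [extChartAt_source] at hx)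

theorem hasMFDerivAt_chart_symm (hz : z ∈ (extChartAt (𝓡 m) x₀).target) :
    HasMFDerivAt 𝓘(ℝ, EuclideanSpace ℝ (Fin m)) (𝓡 m) (extChartAt (𝓡 m) x₀).symm z
      (chartSymmD x₀ z) :=
  ((contMDiffAt_chart_symm hz).mdifferentiableAt (by simp)).hasMFDerivAt

/-- The image of a smooth vector field along a map under the tangent map of a chart is smooth. -/
theorem contMDiffAt_chartD_apply {H E' N : Type*} [NormedAddCommGroup E'] [NormedSpace ℝ E']
    [TopologicalSpace H] {I : ModelWithCorners ℝ E' H} [TopologicalSpace N] [ChartedSpace H N]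
    {f : N → M} {X : ∀ y, TangentSpace (𝓡 m) (f y)} {y : N}
    (hX : ContMDiffAt I (𝓡 m).tangent ∞ (fun y => (⟨f y, X y⟩ : TangentBundle (𝓡 m) M)) y)
    (hy : f y ∈ (extChartAt (𝓡 m) x₀).source) :
    ContMDiffAt I 𝓘(ℝ, EuclideanSpace ℝ (Fin m)) ∞ (fun y => chartD x₀ (f y) (X y)) y := by
  have hopen := isOpen_extChartAt_source (I := 𝓡 m) x₀
  have h1 : ContMDiffOn (𝓡 m).tangent 𝓘(ℝ, EuclideanSpace ℝ (Fin m)).tangent ∞ _ _ :=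
    ContMDiffOn.contMDiffOn_tangentMapWithin
    (f := extChartAt (𝓡 m) x₀) (I := 𝓡 m) (s := (extChartAt (𝓡 m) x₀).source) (m := ∞) (n := ∞)
    (I' := 𝓘(ℝ, EuclideanSpace ℝ (Fin m)))
    (fun x hx => (contMDiffAt_chart hx).contMDiffWithinAt) le_rfl hopen.uniqueMDiffOn
  have h2 := h1.contMDiffAt (x := (⟨f y, X y⟩ : TangentBundle (𝓡 m) M))
    ((hopen.preimage (FiberBundle.continuous_proj _ _)).mem_nhds hy)
  have h3 := (contMDiff_snd_tangentBundle_modelSpace (n := ∞) (EuclideanSpace ℝ (Fin m))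
    𝓘(ℝ, EuclideanSpace ℝ (Fin m))).contMDiffAt.comp y (h2.comp y hX)
  refine h3.congr_of_eventuallyEq ?_
  have hc : ContinuousAt f y :=
    (FiberBundle.continuous_proj (EuclideanSpace ℝ (Fin m))
      (TangentSpace (𝓡 m) : M → Type _)).continuousAt.comp hX.continuousAt
  filter_upwards [hc (hopen.mem_nhds hy)] with w hw
  change chartD x₀ (f w) (X w) = mfderivWithin _ _ _ _ _ _
  rw [mfderivWithin_of_isOpen hopen hw]
  rfl

end Charts

/-! ### Local first integrals of involutive distributions -/

section Foliation

variable {n r : ℕ} {Q : Type*} [TopologicalSpace Q] [ChartedSpace (EuclideanSpace ℝ (Fin n)) Q]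

/-- `h` is a first integral on the open set `B` of the distribution `F`, and its level sets in `B`
are, locally, the leaves of `F`. -/
structure IsFoliationBox (F : ∀ q : Q, Submodule ℝ (TangentSpace (𝓡 n) q)) (B : Set Q)
    (h : Q → EuclideanSpace ℝ (Fin n)) : Prop where
  isOpen : IsOpen B
  continuousOn : ContinuousOn h B
  hasDerivWithinAt_zero : ∀ (c : ℝ → Q) (s : Set ℝ) (t : ℝ) (v : ℝ →L[ℝ] TangentSpace (𝓡 n) (c t)),
    HasMFDerivWithinAt 𝓘(ℝ, ℝ) (𝓡 n) c s t v → c t ∈ B → v 1 ∈ F (c t) →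
    HasDerivWithinAt (fun x => h (c x)) 0 s t
  -- Confining the curve to an arbitrary neighbourhood `U` is what makes two boxes comparable.
  exists_curve : ∀ p ∈ B, ∀ U ∈ 𝓝 p, ∃ N ∈ 𝓝 p, ∀ p' ∈ N, h p' = h p →
    ∃ c : ℝ → Q, c 0 = p ∧ c 1 = p' ∧ ∀ t ∈ Icc (0 : ℝ) 1, c t ∈ U ∧
      ∃ v : ℝ →L[ℝ] TangentSpace (𝓡 n) (c t),
        HasMFDerivWithinAt 𝓘(ℝ, ℝ) (𝓡 n) c (Icc 0 1) t v ∧ v 1 ∈ F (c t)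
  tangent : ∀ (c : ℝ → Q) (t : ℝ) (v : ℝ →L[ℝ] TangentSpace (𝓡 n) (c t)),
    HasMFDerivAt 𝓘(ℝ, ℝ) (𝓡 n) c t v → c t ∈ B → (∀ᶠ x in 𝓝 t, h (c x) = h (c t)) →
    v 1 ∈ F (c t)

variable [IsManifold (𝓡 n) ∞ Q]

theorem mlieBracket_eq_lieBracket {E : Type*} [NormedAddCommGroup E] [NormedSpace ℝ E]
    (X Y : ∀ z : E, TangentSpace 𝓘(ℝ, E) z) :
    VectorField.mlieBracket 𝓘(ℝ, E) X Y = VectorField.lieBracket ℝ X Y := by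
  rw [← VectorField.mlieBracketWithin_univ, VectorField.mlieBracketWithin_eq_lieBracketWithin]
  exact VectorField.lieBracketWithin_univ

/-- The expression of an involutive distribution in a chart is involutive. -/
theorem IsInvolutive.lieBracket_mem {F : ∀ q : Q, Submodule ℝ (TangentSpace (𝓡 n) q)}
    (hF : IsInvolutive F) (q₀ : Q) {U : Set (EuclideanSpace ℝ (Fin n))} (hU : IsOpen U)
    (hUt : U ⊆ (extChartAt (𝓡 n) q₀).target)
    {X Y : EuclideanSpace ℝ (Fin n) → EuclideanSpace ℝ (Fin n)}
    (hX : ContDiffOn ℝ ∞ X U) (hY : ContDiffOn ℝ ∞ Y U)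
    (hXF : ∀ z ∈ U, chartSymmD q₀ z (X z) ∈ F ((extChartAt (𝓡 n) q₀).symm z))
    (hYF : ∀ z ∈ U, chartSymmD q₀ z (Y z) ∈ F ((extChartAt (𝓡 n) q₀).symm z))
    {z : EuclideanSpace ℝ (Fin n)} (hz : z ∈ U) :
    chartSymmD q₀ z (VectorField.lieBracket ℝ X Y z) ∈ F ((extChartAt (𝓡 n) q₀).symm z) := by
  set φ := extChartAt (𝓡 n) q₀ with hφ
  set V : Set Q := φ.source ∩ φ ⁻¹' U with hV
  have hVo : IsOpen V := by
    exact (continuousOn_extChartAt q₀).isOpen_inter_preimage (isOpen_extChartAt_source q₀) hU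
  have hinv : ∀ q ∈ V, ∀ u, (chartD q₀ q).inverse u = chartSymmD q₀ (φ q) u := by
    intro q hq u
    refine (isInvertible_chartD (m := n) hq.1).inverse_apply_eq.2 ?_
    have := chartD_chartSymmD (hUt hq.2) u
    rw [← hφ, φ.left_inv hq.1] at this
    exact this.symm
  -- The fields are pulled back to `Q`, where involutivity applies; naturality of the bracket under
  -- pullback brings the result back to the chart.
  let pb : (EuclideanSpace ℝ (Fin n) → EuclideanSpace ℝ (Fin n)) → ∀ q : Q, TangentSpace (𝓡 n) q :=
    fun X => VectorField.mpullback (𝓡 n) 𝓘(ℝ, EuclideanSpace ℝ (Fin n)) φ X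
  have hpb : ∀ X q, q ∈ V → pb X q = chartSymmD q₀ (φ q) (X (φ q)) := fun X q hq => hinv q hq _
  have hsm : ∀ X, ContDiffOn ℝ ∞ X U → ContMDiffOn (𝓡 n) (𝓡 n).tangent ∞
      (fun q => (⟨q, pb X q⟩ : TangentBundle (𝓡 n) Q)) V := by
    intro X hX q hq
    refine ContMDiffAt.contMDiffWithinAt ?_
    refine ContMDiffAt.mpullback_vectorField_preimage (n := ∞) ?_ (contMDiffAt_chart hq.1)
      (isInvertible_chartD hq.1) le_rfl
    exact contMDiffAt_vectorSpace_iff_contDiffAt.2 (hX.contDiffAt (hU.mem_nhds hq.2))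
  have hmem : ∀ X, (∀ z ∈ U, chartSymmD q₀ z (X z) ∈ F (φ.symm z)) → ∀ q ∈ V, pb X q ∈ F q := by
    intro X hX q hq
    rw [hpb X q hq]
    have := hX _ hq.2
    rwa [φ.left_inv hq.1] at this
  have hzt := hUt hz
  have hq : φ.symm z ∈ V := ⟨φ.map_target hzt, by rw [mem_preimage, φ.right_inv hzt]; exact hz⟩
  have key := hF V hVo _ _ (hsm X hX) (hsm Y hY) (hmem X hXF) (hmem Y hYF) _ hq
  have hφz : φ (φ.symm z) = z := φ.right_inv hzt
  have hMD : ∀ X, ContDiffOn ℝ ∞ X U → MDifferentiableAt 𝓘(ℝ, EuclideanSpace ℝ (Fin n))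
      𝓘(ℝ, EuclideanSpace ℝ (Fin n)).tangent (fun z => (⟨z, X z⟩ : TangentBundle
        𝓘(ℝ, EuclideanSpace ℝ (Fin n)) (EuclideanSpace ℝ (Fin n)))) (φ (φ.symm z)) := by
    intro X hX
    rw [hφz]
    exact (contMDiffAt_vectorSpace_iff_contDiffAt.2 (hX.contDiffAt (hU.mem_nhds hz))).mdifferentiableAt
      (by simp)
  have h2 : minSmoothness ℝ 2 = 2 := minSmoothness_of_isRCLikeNormedField
  have : IsManifold (𝓡 n) (minSmoothness ℝ 2) Q := by rw [h2]; infer_instance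
  have hbr := VectorField.mpullback_mlieBracket (hMD X hX) (hMD Y hY)
    (contMDiffAt_chart (φ.map_target hzt)) (n := ∞) (by rw [h2]; exact WithTop.coe_le_coe.2 le_top)
  change _ = VectorField.mlieBracket (𝓡 n) (pb X) (pb Y) (φ.symm z) at hbr
  rw [← hbr] at key
  replace key := Eq.mp (congrArg (fun Z : ∀ z : EuclideanSpace ℝ (Fin n),
    TangentSpace 𝓘(ℝ, EuclideanSpace ℝ (Fin n)) z => VectorField.mpullback (𝓡 n)
      𝓘(ℝ, EuclideanSpace ℝ (Fin n)) φ Z (φ.symm z) ∈ F (φ.symm z))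
    (mlieBracket_eq_lieBracket X Y)) key
  have := hpb (VectorField.lieBracket ℝ X Y) _ hq
  rw [hφz] at this
  exact this ▸ key

set_option maxHeartbeats 400000 in
/-- The local Frobenius theorem. -/
theorem exists_isFoliationBox {F : ∀ q : Q, Submodule ℝ (TangentSpace (𝓡 n) q)}
    (hd : IsDistribution F r) (hF : IsInvolutive F) (q₀ : Q) :
    ∃ B h, q₀ ∈ B ∧ IsFoliationBox F B h := by
  obtain ⟨U, hU, hq₀, s, hs, hspan⟩ := hd q₀
  set φ := extChartAt (𝓡 n) q₀ with hφ
  set Ω : Set (EuclideanSpace ℝ (Fin n)) := φ.target ∩ φ.symm ⁻¹' U with hΩdef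
  have hΩ : IsOpen Ω :=
    (continuousOn_extChartAt_symm q₀).isOpen_inter_preimage (isOpen_extChartAt_target q₀) hU
  have hz₀ : φ q₀ ∈ Ω := ⟨mem_extChartAt_target q₀, by
    rw [mem_preimage, φ.left_inv (mem_extChartAt_source q₀)]; exact hq₀⟩
  let ŝ : Fin r → EuclideanSpace ℝ (Fin n) → EuclideanSpace ℝ (Fin n) := fun i z =>
    chartD q₀ (φ.symm z) (s i (φ.symm z))
  have hŝ : ∀ i, ContDiffOn ℝ ∞ (ŝ i) Ω := by
    intro i z hz
    refine ContMDiffAt.contDiffAt ?_ |>.contDiffWithinAt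
    refine contMDiffAt_chartD_apply (f := φ.symm) (X := fun z => s i (φ.symm z)) ?_
      (φ.map_target hz.1)
    exact ((hs i).contMDiffAt (hU.mem_nhds hz.2)).comp z (contMDiffAt_chart_symm hz.1)
  let S₀ : EuclideanSpace ℝ (Fin n) → (Fin r → ℝ) →L[ℝ] EuclideanSpace ℝ (Fin n) := fun z =>
    ∑ i, (ContinuousLinearMap.proj i : (Fin r → ℝ) →L[ℝ] ℝ).smulRight (ŝ i z)
  have hS₀a : ∀ z a, S₀ z a = chartD q₀ (φ.symm z) (∑ i, a i • s i (φ.symm z)) := by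
    intro z a
    simp [S₀, ŝ, map_sum]
  have hS₀ : ContDiffOn ℝ ∞ S₀ Ω := by
    refine ContDiffOn.sum fun i _ => ?_
    exact contDiffOn_const.smulRight (hŝ i)
  have hinj : Function.Injective (S₀ (φ q₀)) := by
    rw [injective_iff_map_eq_zero]
    intro a ha
    rw [hS₀a] at ha
    have h1 := (isInvertible_chartD (φ.map_target hz₀.1)).injective
      (ha.trans (map_zero _).symm)
    funext i
    exact Fintype.linearIndependent_iff.1 (hspan _ hz₀.2).1 a h1 i
  -- `F` read in the chart; on `Ω` it is spanned by the frame `S₀`.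
  let G : EuclideanSpace ℝ (Fin n) → Submodule ℝ (EuclideanSpace ℝ (Fin n)) := fun z =>
    (F (φ.symm z)).comap (chartSymmD q₀ z).toLinearMap
  have hG : ∀ z ∈ Ω, G z = (S₀ z).range := by
    intro z hz
    ext u
    change chartSymmD q₀ z u ∈ F (φ.symm z) ↔ _
    rw [← (hspan _ hz.2).2, Submodule.mem_span_range_iff_exists_fun]
    constructor
    · rintro ⟨a, ha⟩
      refine ⟨a, ?_⟩
      change S₀ z a = u
      rw [hS₀a, ha, chartD_chartSymmD hz.1]
    · rintro ⟨a, rfl⟩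
      refine ⟨a, ?_⟩
      change _ = chartSymmD q₀ z (S₀ z a)
      rw [hS₀a]
      have := chartSymmD_chartD (φ.map_target hz.1) (∑ i, a i • s i (φ.symm z))
      rw [← hφ, φ.right_inv hz.1] at this
      exact this.symm
  obtain ⟨h, B, hB, hzB, hBΩ, hcont, h1, h2, h3⟩ := exists_firstIntegral hΩ hz₀ hS₀ hinj hG
    (fun U hUΩ hUo X Y hX hY hXG hYG z hz =>
      hF.lieBracket_mem q₀ hUo (fun z hz => (hUΩ hz).1) hX hY hXG hYG hz)
  have hBt : ∀ q, q ∈ φ.source → φ q ∈ B → ∀ v : TangentSpace (𝓡 n) q,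
      chartD q₀ q v ∈ G (φ q) ↔ v ∈ F q := by
    intro q hq hqB v
    change chartSymmD q₀ (φ q) (chartD q₀ q v) ∈ F (φ.symm (φ q)) ↔ _
    rw [chartSymmD_chartD hq, φ.left_inv hq]
  refine ⟨φ.source ∩ φ ⁻¹' B, fun q => h (φ q), ⟨mem_extChartAt_source q₀, hzB⟩, ?_, ?_, ?_, ?_, ?_⟩
  · exact (continuousOn_extChartAt q₀).isOpen_inter_preimage (isOpen_extChartAt_source q₀) hB
  · exact hcont.comp ((continuousOn_extChartAt q₀).mono inter_subset_left) fun q hq => hq.2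
  · intro c s t v hc hct hv
    have hcd : HasFDerivWithinAt (fun x => φ (c x))
        ((chartD q₀ (c t)).comp v : ℝ →L[ℝ] EuclideanSpace ℝ (Fin n)) s t :=
      ((hasMFDerivAt_chart hct.1).comp_hasMFDerivWithinAt t hc).hasFDerivWithinAt
    exact h1 _ _ s t hcd.hasDerivWithinAt hct.2 ((hBt _ hct.1 hct.2 _).2 hv)
  · rintro p ⟨hp, hpB⟩ U' hU'
    have hsymm : ContinuousAt φ.symm (φ p) := continuousAt_extChartAt_symm' hp
    have hpre : φ.symm ⁻¹' U' ∩ Ω ∈ 𝓝 (φ p) := by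
      refine Filter.inter_mem (hsymm ?_) (hΩ.mem_nhds (hBΩ hpB))
      rwa [φ.left_inv hp]
    obtain ⟨N, hN, hcurve⟩ := h2 _ hpB _ hpre
    refine ⟨φ ⁻¹' N ∩ φ.source, Filter.inter_mem ((continuousAt_extChartAt' hp) hN)
      ((isOpen_extChartAt_source q₀).mem_nhds hp), ?_⟩
    rintro p' ⟨hp'N, hp'⟩ heq
    obtain ⟨α, hα0, hα1, hα⟩ := hcurve _ hp'N heq
    refine ⟨fun t => φ.symm (α t), by simp only [hα0, φ.left_inv hp],
      by simp only [hα1, φ.left_inv hp'],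
      fun t ht => ?_⟩
    obtain ⟨⟨hU, hΩt⟩, v, hv, hd⟩ := hα t ht
    refine ⟨hU, (chartSymmD q₀ (α t)).comp (ContinuousLinearMap.toSpanSingleton ℝ v), ?_, ?_⟩
    · exact (hasMFDerivAt_chart_symm hΩt.1).comp_hasMFDerivWithinAt t hd.hasFDerivWithinAt.hasMFDerivWithinAt
    · have : (ContinuousLinearMap.toSpanSingleton ℝ v) 1 = v := by simp
      change chartSymmD q₀ (α t) ((ContinuousLinearMap.toSpanSingleton ℝ v) 1) ∈ _
      rw [this]
      exact hv
  · intro c t v hc hct hev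
    have hcd : HasFDerivWithinAt (fun x => φ (c x))
        ((chartD q₀ (c t)).comp v : ℝ →L[ℝ] EuclideanSpace ℝ (Fin n)) univ t :=
      ((hasMFDerivAt_chart hct.1).comp_hasMFDerivWithinAt t
        (hc.hasMFDerivWithinAt (s := univ))).hasFDerivWithinAt
    rw [hasFDerivWithinAt_univ] at hcd
    exact (hBt _ hct.1 hct.2 _).1 (h3 _ _ t hcd.hasDerivAt hct.2 hev)

end Foliation

/-! ### Leaves of involutive distributions -/

section Leaves

variable {n r : ℕ} {Q : Type*} [TopologicalSpace Q] [ChartedSpace (EuclideanSpace ℝ (Fin n)) Q]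
  {F : ∀ q : Q, Submodule ℝ (TangentSpace (𝓡 n) q)}

namespace IsFoliationBox

variable {B B' : Set Q} {h h' : Q → EuclideanSpace ℝ (Fin n)}

theorem eq_of_curve (H : IsFoliationBox F B h) {c : ℝ → Q} {J : Set ℝ} (hJ : Convex ℝ J)
    (hc : ∀ t ∈ J, c t ∈ B ∧ ∃ v : ℝ →L[ℝ] TangentSpace (𝓡 n) (c t),
      HasMFDerivWithinAt 𝓘(ℝ, ℝ) (𝓡 n) c J t v ∧ v 1 ∈ F (c t))
    {a b : ℝ} (ha : a ∈ J) (hb : b ∈ J) : h (c b) = h (c a) := by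
  have hd : ∀ t ∈ J, HasDerivWithinAt (fun x => h (c x)) 0 J t := by
    intro t ht
    obtain ⟨hB, v, hv, hvF⟩ := hc t ht
    exact H.hasDerivWithinAt_zero c J t v hv hB hvF
  have := hJ.norm_image_sub_le_of_norm_hasDerivWithin_le (C := 0) hd (fun _ _ => by simp) ha hb
  rw [zero_mul] at this
  exact sub_eq_zero.1 (norm_le_zero_iff.1 this)

/-- Near `p`, a plaque of one box lies in a plaque of the other: the joining curve can be chosen
inside `B'`, and `h'` is constant along it. -/
theorem eventually_eq (H : IsFoliationBox F B h) (H' : IsFoliationBox F B' h') {p : Q}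
    (hp : p ∈ B) (hp' : p ∈ B') : ∀ᶠ p' in 𝓝 p, h p' = h p → h' p' = h' p := by
  obtain ⟨N, hN, hcurve⟩ := H.exists_curve p hp B' (H'.isOpen.mem_nhds hp')
  filter_upwards [hN] with p' hp'N heq
  obtain ⟨c, h0, h1, hc⟩ := hcurve p' hp'N heq
  rw [← h0, ← h1]
  exact H'.eq_of_curve (convex_Icc 0 1) hc (by simp) (by simp)

end IsFoliationBox

/-- A set is thin if it meets only countably many plaques of each foliation box. -/
def IsThin (F : ∀ q : Q, Submodule ℝ (TangentSpace (𝓡 n) q)) (L : Set Q) : Prop :=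
  ∀ B h, IsFoliationBox F B h → (h '' (L ∩ B)).Countable

theorem isThin_singleton (q : Q) : IsThin F {q} := fun _ _ _ =>
  ((countable_singleton q).mono inter_subset_left).image _

theorem IsThin.iUnion {ι : Sort*} [Countable ι] {L : ι → Set Q} (hL : ∀ i, IsThin F (L i)) :
    IsThin F (⋃ i, L i) := by
  intro B h H
  rw [iUnion_inter, image_iUnion]
  exact countable_iUnion fun i => hL i B h H

theorem IsThin.biUnion {ι : Type*} {s : Set ι} (hs : s.Countable) {L : ι → Set Q}
    (hL : ∀ i ∈ s, IsThin F (L i)) : IsThin F (⋃ i ∈ s, L i) := by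
  rw [biUnion_eq_iUnion]
  have := hs.to_subtype
  exact IsThin.iUnion fun i => hL i i.2

/-- Plaques are thin. -/
theorem IsFoliationBox.isThin_plaque [SecondCountableTopology Q] {B : Set Q}
    {h : Q → EuclideanSpace ℝ (Fin n)} (H : IsFoliationBox F B h) (e : EuclideanSpace ℝ (Fin n)) :
    IsThin F {p | p ∈ B ∧ h p = e} := by
  intro B' h' H'
  have hN : ∀ p ∈ {p | p ∈ B ∧ h p = e} ∩ B',
      {p' | h p' = h p → h' p' = h' p} ∈ 𝓝[{p | p ∈ B ∧ h p = e} ∩ B'] p := fun p hp =>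
    mem_nhdsWithin_of_mem_nhds (H.eventually_eq H' hp.1.1 hp.2)
  -- Each point of the plaque in `B'` has a relative neighbourhood on which `h'` is constant;
  -- countably many of these cover, so `h'` takes countably many values.
  obtain ⟨t, hts, htc, hcov⟩ := TopologicalSpace.countable_cover_nhdsWithin hN
  refine (htc.image h').mono ?_
  rintro _ ⟨p, hp, rfl⟩
  obtain ⟨x, hx, hpx⟩ := mem_iUnion₂.1 (hcov hp)
  exact ⟨x, hx, (hpx (hp.1.2.trans (hts hx).1.2.symm)).symm⟩

/-- Through every point passes a thin set which is saturated with respect to a cover by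
foliation boxes. -/
theorem exists_isThin_saturated [SecondCountableTopology Q] {B : Q → Set Q}
    {h : Q → Q → EuclideanSpace ℝ (Fin n)} (H : ∀ i, IsFoliationBox F (B i) (h i))
    {I : Set Q} (hI : I.Countable) (q : Q) :
    ∃ L : Set Q, q ∈ L ∧ IsThin F L ∧
      ∀ i ∈ I, ∀ p ∈ B i, ∀ p' ∈ B i, h i p' = h i p → p ∈ L → p' ∈ L := by
  -- `sat` collects all plaques that meet `L`, over countably many boxes. For thin `L` these are
  -- countably many plaques, so thinness survives each step and the countable union of the iterates.
  let sat : Set Q → Set Q := fun L => ⋃ i ∈ I, ⋃ e ∈ h i '' (L ∩ B i), {p | p ∈ B i ∧ h i p = e}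
  have hsat : ∀ L, IsThin F L → IsThin F (sat L) := fun L hL =>
    IsThin.biUnion hI fun i _ => IsThin.biUnion (hL _ _ (H i)) fun e _ => (H i).isThin_plaque e
  have hiter : ∀ N, IsThin F (sat^[N] {q}) := by
    intro N
    induction N with
    | zero => exact isThin_singleton q
    | succ N ih =>
      rw [Function.iterate_succ_apply']
      exact hsat _ ih
  refine ⟨⋃ N, sat^[N] {q}, mem_iUnion.2 ⟨0, rfl⟩, IsThin.iUnion hiter, ?_⟩
  intro i hi p hp p' hp' heq hpL
  obtain ⟨N, hN⟩ := mem_iUnion.1 hpL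
  refine mem_iUnion.2 ⟨N + 1, ?_⟩
  rw [Function.iterate_succ_apply']
  exact mem_iUnion₂.2 ⟨i, hi, mem_iUnion₂.2 ⟨h i p, ⟨p, ⟨hN, hp⟩, rfl⟩, hp', heq⟩⟩

/-- Reachable points lie in a thin set: the leaf of `F`. -/
theorem exists_isThin_of_reachable [SecondCountableTopology Q]
    (hbox : ∀ q : Q, ∃ B h, q ∈ B ∧ IsFoliationBox F B h) (q : Q) :
    ∃ L : Set Q, q ∈ L ∧ IsThin F L ∧ ∀ p p', Reachable F p p' → (p ∈ L ↔ p' ∈ L) := by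
  choose B h hmem H using hbox
  obtain ⟨I, hI, hcov⟩ := TopologicalSpace.countable_cover_nhds
    fun q => (H q).isOpen.mem_nhds (hmem q)
  obtain ⟨L, hqL, hL, hsat⟩ := exists_isThin_saturated H hI q
  refine ⟨L, hqL, hL, fun p p' hpp' => ?_⟩
  induction hpp' with
  | refl => exact Iff.rfl
  | tail _ hstep ih =>
    refine ih.trans ?_
    obtain ⟨a, b, c, hab, hc, hcF, rfl, rfl⟩ := hstep
    -- Membership in `L` is locally constant along `c`: near each time `c` stays in one box of the
    -- cover, hence in one plaque, and `L` is saturated. Connectedness of the interval does the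
    -- rest.
    refine isPreconnected_Icc.induction₂ (s := Icc a b) (fun x y => c x ∈ L ↔ c y ∈ L) ?_
      (fun x y z _ _ _ h1 h2 => h1.trans h2) (fun x y _ _ h => h.symm) (left_mem_Icc.2 hab.le)
      (right_mem_Icc.2 hab.le)
    intro t ht
    obtain ⟨i, hi, hti⟩ := mem_iUnion₂.1 (hcov ▸ mem_univ (c t))
    have hnear : ∀ᶠ x in 𝓝[Icc a b] t, c x ∈ B i :=
      (hc.continuousOn t ht).eventually ((H i).isOpen.mem_nhds hti)
    obtain ⟨δ, hδ, hsub⟩ := Metric.mem_nhdsWithin_iff.1 hnear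
    have hJ : Convex ℝ (Metric.ball t δ ∩ Icc a b) := (convex_ball t δ).inter (convex_Icc a b)
    filter_upwards [inter_mem_nhdsWithin (Icc a b) (Metric.ball_mem_nhds t hδ)] with x hx
    have heq := (H i).eq_of_curve (c := c) hJ (fun s hs => ⟨hsub hs, _,
      ((hc.mdifferentiableOn (by simp) s hs.2).hasMFDerivWithinAt).mono inter_subset_right,
      hcF s hs.2⟩) ⟨Metric.mem_ball_self hδ, ht⟩ ⟨hx.2, hx.1⟩
    have hxB := hsub ⟨hx.2, hx.1⟩
    exact ⟨hsat i hi _ hti _ hxB heq, hsat i hi _ hxB _ hti heq.symm⟩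

/-- A curve of points which are reachable from, or lead to, a fixed point is tangent to the
involutive distribution. -/
theorem tangent_of_reachable [IsManifold (𝓡 n) ∞ Q] [SecondCountableTopology Q]
    (hd : IsDistribution F r) (hF : IsInvolutive F) {q : Q} {c : ℝ → Q} {t : ℝ}
    {v : ℝ →L[ℝ] TangentSpace (𝓡 n) (c t)} (hv : HasMFDerivAt 𝓘(ℝ, ℝ) (𝓡 n) c t v)
    (hc : ∀ᶠ s in 𝓝 t, ContinuousAt c s)
    (hr : ∀ᶠ s in 𝓝 t, Reachable F q (c s) ∨ Reachable F (c s) q) : v 1 ∈ F (c t) := by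
  have hbox := exists_isFoliationBox hd hF
  obtain ⟨L, hqL, hL, hreach⟩ := exists_isThin_of_reachable hbox q
  obtain ⟨B, h, hB, H⟩ := hbox (c t)
  refine H.tangent c t v hv hB ?_
  have hcB : ∀ᶠ s in 𝓝 t, c s ∈ B := hv.continuousAt.eventually (H.isOpen.mem_nhds hB)
  obtain ⟨δ, hδ, hball⟩ := Metric.eventually_nhds_iff_ball.1 (hc.and (hr.and hcB))
  have hcont : ContinuousOn (fun s => h (c s)) (Metric.ball t δ) := fun s hs =>
    (H.continuousOn.continuousAt (H.isOpen.mem_nhds (hball s hs).2.2)).comp_continuousWithinAt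
      (hball s hs).1.continuousWithinAt
  have hcount : ((fun s => h (c s)) '' Metric.ball t δ).Countable := by
    refine (hL B h H).mono ?_
    rintro _ ⟨s, hs, rfl⟩
    refine ⟨c s, ⟨?_, (hball s hs).2.2⟩, rfl⟩
    rcases (hball s hs).2.1 with h1 | h1
    · exact (hreach _ _ h1).1 hqL
    · exact (hreach _ _ h1).2 hqL
  -- The image of an interval under `h ∘ c` is connected and countable, hence a single point.
  have hsub := hcount.isTotallyDisconnected _ Subset.rfl
    ((convex_ball t δ).isPreconnected.image _ hcont)
  filter_upwards [Metric.ball_mem_nhds t hδ] with s hs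
  exact hsub ⟨s, hs, rfl⟩ ⟨t, Metric.mem_ball_self hδ, rfl⟩

end Leaves

/-! ### Maps and one-forms in charts -/

section Charts

variable {m n : ℕ}
  {M : Type*} [TopologicalSpace M] [ChartedSpace (EuclideanSpace ℝ (Fin m)) M]
  {Q : Type*} [TopologicalSpace Q] [ChartedSpace (EuclideanSpace ℝ (Fin n)) Q]

/-- The expression of `f` in the charts at `x₀` and `f x₀`. -/
def inCharts (f : M → Q) (x₀ : M) (z : EuclideanSpace ℝ (Fin m)) : EuclideanSpace ℝ (Fin n) :=
  extChartAt (𝓡 n) (f x₀) (f ((extChartAt (𝓡 m) x₀).symm z))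

/-- The domain of the expression of `f` in charts. -/
def inChartsDomain (f : M → Q) (x₀ : M) : Set (EuclideanSpace ℝ (Fin m)) :=
  {z | z ∈ (extChartAt (𝓡 m) x₀).target ∧
    f ((extChartAt (𝓡 m) x₀).symm z) ∈ (extChartAt (𝓡 n) (f x₀)).source}

theorem inChartsDomain_mem_nhds {f : M → Q} {x₀ : M} (hf : ContinuousAt f x₀) :
    inChartsDomain (m := m) (n := n) f x₀ ∈ 𝓝 (extChartAt (𝓡 m) x₀ x₀) := by
  refine Filter.inter_mem (extChartAt_target_mem_nhds x₀) ?_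
  have h1 : ContinuousAt (extChartAt (𝓡 m) x₀).symm (extChartAt (𝓡 m) x₀ x₀) :=
    continuousAt_extChartAt_symm x₀
  have h2 : ContinuousAt f ((extChartAt (𝓡 m) x₀).symm (extChartAt (𝓡 m) x₀ x₀)) := by
    rwa [extChartAt_to_inv]
  refine (h2.comp h1).preimage_mem_nhds ?_
  simp only [Function.comp_apply, extChartAt_to_inv]
  exact extChartAt_source_mem_nhds (f x₀)

variable [IsManifold (𝓡 m) ∞ M] [IsManifold (𝓡 n) ∞ Q]

theorem contDiffAt_inCharts {f : M → Q} (hf : ContMDiff (𝓡 m) (𝓡 n) ∞ f) {x₀ : M}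
    {z : EuclideanSpace ℝ (Fin m)} (hz : z ∈ inChartsDomain (n := n) f x₀) :
    ContDiffAt ℝ ∞ (inCharts (n := n) f x₀) z := by
  refine ContMDiffAt.contDiffAt ?_
  exact (contMDiffAt_chart hz.2).comp z (hf.contMDiffAt.comp z (contMDiffAt_chart_symm hz.1))

theorem fderiv_inCharts_apply {f : M → Q} (hf : ContMDiff (𝓡 m) (𝓡 n) ∞ f) {x₀ : M}
    {z : EuclideanSpace ℝ (Fin m)} (hz : z ∈ inChartsDomain (n := n) f x₀)
    (u : EuclideanSpace ℝ (Fin m)) :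
    fderiv ℝ (inCharts (n := n) f x₀) z u =
      chartD (f x₀) (f ((extChartAt (𝓡 m) x₀).symm z))
        (mfderiv (𝓡 m) (𝓡 n) f ((extChartAt (𝓡 m) x₀).symm z) (chartSymmD x₀ z u)) := by
  have h1 := (hf.mdifferentiableAt (by simp) :
    MDifferentiableAt (𝓡 m) (𝓡 n) f ((extChartAt (𝓡 m) x₀).symm z)).hasMFDerivAt
  have h2 := HasMFDerivAt.comp z h1 (hasMFDerivAt_chart_symm hz.1)
  have h3 := HasMFDerivAt.comp z (hasMFDerivAt_chart hz.2) h2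
  have h4 : HasFDerivAt (inCharts (n := n) f x₀)
      ((chartD (f x₀) (f ((extChartAt (𝓡 m) x₀).symm z))).comp
        ((mfderiv (𝓡 m) (𝓡 n) f ((extChartAt (𝓡 m) x₀).symm z)).comp (chartSymmD x₀ z)) :
        EuclideanSpace ℝ (Fin m) →L[ℝ] EuclideanSpace ℝ (Fin n)) z := h3.hasFDerivAt
  exact congrArg (fun L : EuclideanSpace ℝ (Fin m) →L[ℝ] EuclideanSpace ℝ (Fin n) => L u) h4.fderiv

/-- The expression of a smooth one-form in a chart is smooth. -/
theorem OneForm.IsSmooth.contDiffAt_inChart {θ : OneForm m M} (hθ : θ.IsSmooth) {x₀ : M}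
    {z : EuclideanSpace ℝ (Fin m)} (hz : z ∈ (extChartAt (𝓡 m) x₀).target) :
    ContDiffAt ℝ ∞ (θ.inChart x₀) z := by
  have hopen := isOpen_extChartAt_target (I := 𝓡 m) x₀
  suffices h : ContDiffOn ℝ ∞ (θ.inChart x₀) (extChartAt (𝓡 m) x₀).target from
    h.contDiffAt (hopen.mem_nhds hz)
  rw [contDiffOn_clm_apply]
  intro w z hz
  refine ContMDiffAt.contDiffAt ?_ |>.contDiffWithinAt
  have h1 : ContMDiffOn 𝓘(ℝ, EuclideanSpace ℝ (Fin m)).tangent (𝓡 m).tangent ∞ _ _ :=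
    ContMDiffOn.contMDiffOn_tangentMapWithin
    (f := (extChartAt (𝓡 m) x₀).symm) (I' := 𝓡 m) (s := (extChartAt (𝓡 m) x₀).target) (m := ∞)
    (n := ∞) (I := 𝓘(ℝ, EuclideanSpace ℝ (Fin m)))
    (fun x hx => (contMDiffAt_chart_symm hx).contMDiffWithinAt) le_rfl hopen.uniqueMDiffOn
  have h2 := h1.contMDiffAt (x := (⟨z, w⟩ : TangentBundle 𝓘(ℝ, EuclideanSpace ℝ (Fin m))
    (EuclideanSpace ℝ (Fin m)))) ((hopen.preimage (FiberBundle.continuous_proj _ _)).mem_nhds hz)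
  have h0 : ContMDiffAt 𝓘(ℝ, EuclideanSpace ℝ (Fin m)) 𝓘(ℝ, EuclideanSpace ℝ (Fin m)).tangent ∞
      (fun z => (⟨z, w⟩ : TangentBundle 𝓘(ℝ, EuclideanSpace ℝ (Fin m))
        (EuclideanSpace ℝ (Fin m)))) z :=
    contMDiffAt_vectorSpace_iff_contDiffAt.2 contDiffAt_const
  have h3 := hθ.contMDiffAt.comp z (h2.comp z h0)
  refine h3.congr_of_eventuallyEq ?_
  filter_upwards [hopen.mem_nhds hz] with y hy
  change θ ((extChartAt (𝓡 m) x₀).symm y) (chartSymmD x₀ y w) =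
    θ ((extChartAt (𝓡 m) x₀).symm y) (mfderivWithin _ _ _ _ _ _)
  rw [mfderivWithin_of_isOpen hopen hy]
  rfl

/-- The tangent map at `x` of the chart at `x` is the identity of the model space. -/
theorem OneForm.d_eq (θ : OneForm m M) (x : M) (a b : EuclideanSpace ℝ (Fin m)) :
    θ.d x a b = fderiv ℝ (θ.inChart x) (extChartAt (𝓡 m) x x) a b -
      fderiv ℝ (θ.inChart x) (extChartAt (𝓡 m) x x) b a := by
  have h : ∀ a : EuclideanSpace ℝ (Fin m), chartD x x a = a := fun a =>
    congrArg (fun L : EuclideanSpace ℝ (Fin m) →L[ℝ] EuclideanSpace ℝ (Fin m) => L a) chartD_self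
  change fderiv ℝ (θ.inChart x) (extChartAt (𝓡 m) x x) (chartD x x a) (chartD x x b) -
    fderiv ℝ (θ.inChart x) (extChartAt (𝓡 m) x x) (chartD x x b) (chartD x x a) = _
  rw [h, h]

/-- The exterior derivative of the one-form `μ ∘ dg`. -/
theorem fderiv_comp_fderiv_antisymm {E G : Type*} [NormedAddCommGroup E] [NormedSpace ℝ E]
    [NormedAddCommGroup G] [NormedSpace ℝ G] {μ : E → G →L[ℝ] ℝ} {g : E → G} {ϑ : E → E →L[ℝ] ℝ}
    {z : E} (hμ : DifferentiableAt ℝ μ z) (hg : ContDiffAt ℝ ∞ g z)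
    (hϑ : ϑ =ᶠ[𝓝 z] fun y => (μ y).comp (fderiv ℝ g y)) :
    DifferentiableAt ℝ ϑ z ∧ ∀ a b, fderiv ℝ ϑ z a b - fderiv ℝ ϑ z b a =
      fderiv ℝ μ z a (fderiv ℝ g z b) - fderiv ℝ μ z b (fderiv ℝ g z a) := by
  have hg' : DifferentiableAt ℝ (fderiv ℝ g) z :=
    (hg.fderiv_right (m := ∞) le_rfl).differentiableAt (by simp)
  have hd := (hμ.hasFDerivAt.clm_comp hg'.hasFDerivAt).congr_of_eventuallyEq hϑ
  refine ⟨hd.differentiableAt, fun a b => ?_⟩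
  -- Symmetry of the second derivative removes every term in which `dg` is differentiated.
  have hsymm : fderiv ℝ (fderiv ℝ g) z a b = fderiv ℝ (fderiv ℝ g) z b a :=
    (hg.isSymmSndFDerivAt (by
      rw [minSmoothness_of_isRCLikeNormedField]; exact WithTop.coe_le_coe.2 le_top)) a b
  rw [hd.fderiv]
  simp [hsymm]

end Charts

/-! ### The discrete two-forms -/

section Forms

variable {n : ℕ} {V Q : Type*}
  [TopologicalSpace V] [ChartedSpace (EuclideanSpace ℝ (Fin (2 * n))) V]
  [TopologicalSpace Q] [ChartedSpace (EuclideanSpace ℝ (Fin n)) Q]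

namespace DiscreteTangentBundle

variable (B : DiscreteTangentBundle n V Q)

theorem liftPlus_add_liftMinus (v : V) (a : TangentSpace (𝓡 (2 * n)) v) :
    B.liftPlus v (B.Tplus v a) + B.liftMinus v (B.Tminus v a) = a := by
  have h : B.liftPlus v (B.Tplus v a) + B.liftMinus v (B.Tminus v a) - a = 0 := by
    refine B.ker_inf_ker v _ ?_ ?_
    · change B.Tplus v _ = 0
      rw [map_sub, map_add, B.Tplus_liftPlus, B.Tplus_liftMinus, add_zero, sub_self]
    · change B.Tminus v _ = 0
      rw [map_sub, map_add, B.Tminus_liftPlus, B.Tminus_liftMinus, zero_add, sub_self]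
  exact sub_eq_zero.1 h

/-- This is `δv = δv⁺ + δv⁻` under `σ`; it reduces `ω⁺ = ω⁻` to `dσ = 0`. -/
theorem thetaPlus_eq (σ : OneForm (2 * n) V) (v : V) : B.thetaPlus σ v = B.thetaMinus σ v + σ v := by
  ext a
  change σ v (B.liftPlus v (B.Tplus v a)) = -σ v (B.liftMinus v (B.Tminus v a)) + σ v a
  have h : σ v a = σ v (B.liftPlus v (B.Tplus v a)) + σ v (B.liftMinus v (B.Tminus v a)) := by
    rw [← map_add, B.liftPlus_add_liftMinus]
  linarith

/-- The expression of `T∂^±` in charts. -/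
def TbothInCharts (v : V) (z : EuclideanSpace ℝ (Fin (2 * n))) :
    EuclideanSpace ℝ (Fin (2 * n)) →L[ℝ] EuclideanSpace ℝ (Fin n) × EuclideanSpace ℝ (Fin n) :=
  (fderiv ℝ (inCharts B.plus v) z).prod (fderiv ℝ (inCharts B.minus v) z)

/-- The expression of the lift through `∂⁺` in charts. -/
def liftPlusInCharts (v : V) (z : EuclideanSpace ℝ (Fin (2 * n))) :
    EuclideanSpace ℝ (Fin n) →L[ℝ] EuclideanSpace ℝ (Fin (2 * n)) :=
  (B.TbothInCharts v z).inverse.comp (ContinuousLinearMap.inl ℝ _ _)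

/-- The expression of the lift through `∂⁻` in charts. -/
def liftMinusInCharts (v : V) (z : EuclideanSpace ℝ (Fin (2 * n))) :
    EuclideanSpace ℝ (Fin n) →L[ℝ] EuclideanSpace ℝ (Fin (2 * n)) :=
  (B.TbothInCharts v z).inverse.comp (ContinuousLinearMap.inr ℝ _ _)

/-- The common domain of the expressions of `∂⁺` and `∂⁻` in charts. -/
def chartDomain (v : V) : Set (EuclideanSpace ℝ (Fin (2 * n))) :=
  inChartsDomain (n := n) B.plus v ∩ inChartsDomain (n := n) B.minus v

theorem chartDomain_mem_nhds (v : V) :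
    B.chartDomain v ∈ 𝓝 (extChartAt (𝓡 (2 * n)) v v) :=
  Filter.inter_mem (inChartsDomain_mem_nhds B.submersion_plus.contMDiff.continuous.continuousAt)
    (inChartsDomain_mem_nhds B.submersion_minus.contMDiff.continuous.continuousAt)

variable [IsManifold (𝓡 (2 * n)) ∞ V] [IsManifold (𝓡 n) ∞ Q] {v : V}
  {z : EuclideanSpace ℝ (Fin (2 * n))}

theorem fderiv_plus_inCharts (hz : z ∈ B.chartDomain v) (u : EuclideanSpace ℝ (Fin (2 * n))) :
    fderiv ℝ (inCharts B.plus v) z u = chartD (B.plus v)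
      (B.plus ((extChartAt (𝓡 (2 * n)) v).symm z)) (B.Tplus _ (chartSymmD v z u)) :=
  fderiv_inCharts_apply B.submersion_plus.contMDiff hz.1 u

theorem fderiv_minus_inCharts (hz : z ∈ B.chartDomain v) (u : EuclideanSpace ℝ (Fin (2 * n))) :
    fderiv ℝ (inCharts B.minus v) z u = chartD (B.minus v)
      (B.minus ((extChartAt (𝓡 (2 * n)) v).symm z)) (B.Tminus _ (chartSymmD v z u)) :=
  fderiv_inCharts_apply B.submersion_minus.contMDiff hz.2 u

theorem TbothInCharts_isInvertible (hz : z ∈ B.chartDomain v) :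
    (B.TbothInCharts v z).IsInvertible := by
  have hinj : Function.Injective (B.TbothInCharts v z).toLinearMap := by
    rw [← LinearMap.ker_eq_bot, LinearMap.ker_eq_bot']
    intro w hw
    have h1 : fderiv ℝ (inCharts B.plus v) z w = 0 := congrArg Prod.fst hw
    have h2 : fderiv ℝ (inCharts B.minus v) z w = 0 := congrArg Prod.snd hw
    rw [B.fderiv_plus_inCharts hz] at h1
    rw [B.fderiv_minus_inCharts hz] at h2
    have h3 := (isInvertible_chartD (m := n) hz.1.2).injective (h1.trans (map_zero _).symm)
    have h4 := (isInvertible_chartD (m := n) hz.2.2).injective (h2.trans (map_zero _).symm)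
    have h5 := B.ker_inf_ker _ _ h3 h4
    rw [← chartD_chartSymmD hz.1.1 w, h5, map_zero]
  have hfin : Module.finrank ℝ (EuclideanSpace ℝ (Fin (2 * n))) =
      Module.finrank ℝ (EuclideanSpace ℝ (Fin n) × EuclideanSpace ℝ (Fin n)) := by
    simp [Module.finrank_prod]; ring
  exact ⟨(LinearEquiv.ofInjectiveOfFinrankEq _ hinj hfin).toContinuousLinearEquiv, rfl⟩

/-- A lift is determined by its images under `T∂⁺` and `T∂⁻`, which the charts intertwine. Thus
differentiability of the lifts follows from that of operator inversion. -/
theorem chartSymmD_liftPlusInCharts (hz : z ∈ B.chartDomain v) (w : EuclideanSpace ℝ (Fin n)) :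
    chartSymmD v z (B.liftPlusInCharts v z w) = B.liftPlus ((extChartAt (𝓡 (2 * n)) v).symm z)
      (chartSymmD (B.plus v) (extChartAt (𝓡 n) (B.plus v)
        (B.plus ((extChartAt (𝓡 (2 * n)) v).symm z))) w) := by
  set x := (extChartAt (𝓡 (2 * n)) v).symm z with hx
  have hinv := (B.TbothInCharts_isInvertible hz).self_apply_inverse (w, 0)
  have h1 : fderiv ℝ (inCharts B.minus v) z (B.liftPlusInCharts v z w) = 0 :=
    congrArg Prod.snd hinv
  have h2 : fderiv ℝ (inCharts B.plus v) z (B.liftPlusInCharts v z w) = w :=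
    congrArg Prod.fst hinv
  rw [B.fderiv_minus_inCharts hz] at h1
  rw [B.fderiv_plus_inCharts hz] at h2
  have h3 := (isInvertible_chartD (m := n) hz.2.2).injective (h1.trans (map_zero _).symm)
  have h4 := chartSymmD_chartD hz.1.2 (B.Tplus _ (chartSymmD v z (B.liftPlusInCharts v z w)))
  rw [h2] at h4
  have h5 := B.liftPlus_add_liftMinus x (chartSymmD v z (B.liftPlusInCharts v z w))
  rw [h3, map_zero, add_zero] at h5
  rw [← h5]
  exact congrArg (B.liftPlus x) h4.symm

theorem chartSymmD_liftMinusInCharts (hz : z ∈ B.chartDomain v) (w : EuclideanSpace ℝ (Fin n)) :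
    chartSymmD v z (B.liftMinusInCharts v z w) = B.liftMinus ((extChartAt (𝓡 (2 * n)) v).symm z)
      (chartSymmD (B.minus v) (extChartAt (𝓡 n) (B.minus v)
        (B.minus ((extChartAt (𝓡 (2 * n)) v).symm z))) w) := by
  set x := (extChartAt (𝓡 (2 * n)) v).symm z with hx
  have hinv := (B.TbothInCharts_isInvertible hz).self_apply_inverse (0, w)
  have h1 : fderiv ℝ (inCharts B.plus v) z (B.liftMinusInCharts v z w) = 0 :=
    congrArg Prod.fst hinv
  have h2 : fderiv ℝ (inCharts B.minus v) z (B.liftMinusInCharts v z w) = w :=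
    congrArg Prod.snd hinv
  rw [B.fderiv_plus_inCharts hz] at h1
  rw [B.fderiv_minus_inCharts hz] at h2
  have h3 := (isInvertible_chartD (m := n) hz.1.2).injective (h1.trans (map_zero _).symm)
  have h4 := chartSymmD_chartD hz.2.2 (B.Tminus _ (chartSymmD v z (B.liftMinusInCharts v z w)))
  rw [h2] at h4
  have h5 := B.liftPlus_add_liftMinus x (chartSymmD v z (B.liftMinusInCharts v z w))
  rw [h3, map_zero, zero_add] at h5
  rw [← h5]
  exact congrArg (B.liftMinus x) h4.symm

theorem contDiffAt_TbothInCharts (hz : z ∈ B.chartDomain v) :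
    ContDiffAt ℝ ∞ (B.TbothInCharts v) z := by
  have h : B.TbothInCharts v = fun z =>
      (ContinuousLinearMap.inl ℝ _ _).comp (fderiv ℝ (inCharts B.plus v) z) +
      (ContinuousLinearMap.inr ℝ _ _).comp (fderiv ℝ (inCharts B.minus v) z) := by
    funext z
    ext u <;> simp [TbothInCharts]
  rw [h]
  exact (contDiffAt_const.clm_comp
    ((contDiffAt_inCharts B.submersion_plus.contMDiff hz.1).fderiv_right (m := ∞) le_rfl)).add
    (contDiffAt_const.clm_comp
      ((contDiffAt_inCharts B.submersion_minus.contMDiff hz.2).fderiv_right (m := ∞) le_rfl))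

theorem differentiableAt_inverse_TbothInCharts (hz : z ∈ B.chartDomain v) :
    DifferentiableAt ℝ (fun y => (B.TbothInCharts v y).inverse) z := by
  have h1 := (B.TbothInCharts_isInvertible hz).contDiffAt_map_inverse (n := ∞)
  exact (ContDiffAt.comp z h1 (B.contDiffAt_TbothInCharts hz)).differentiableAt (by simp)

/-- The exterior derivative of `θ⁻` and the form `d^±σ` in charts, in terms of the derivative `A`
of the expression of `σ` on lifted vectors. -/
theorem exists_thetaMinus_d_eq {σ : OneForm (2 * n) V} (hσ : σ.IsSmooth) (v : V) :
    DifferentiableAt ℝ ((B.thetaMinus σ).inChart v) (extChartAt (𝓡 (2 * n)) v v) ∧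
    ∃ A : EuclideanSpace ℝ (Fin (2 * n)) →L[ℝ] EuclideanSpace ℝ (Fin n) →L[ℝ] ℝ,
      (∀ a b : TangentSpace (𝓡 (2 * n)) v, (B.thetaMinus σ).d v a b =
        A b (B.Tminus v a) - A a (B.Tminus v b)) ∧
      ∀ a c, B.dpm σ v a c = A (B.liftPlus v c) a := by
  set φ := extChartAt (𝓡 (2 * n)) v with hφ
  have hz₀ := mem_of_mem_nhds (B.chartDomain_mem_nhds v)
  -- `μ z w` is `σ` on the lift through `∂⁻` of the coordinate vector `w`; in the chart, `θ⁻ = -μ ∘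
  -- d∂⁻`. The derivative of `μ` serves as `A`.
  let μ : EuclideanSpace ℝ (Fin (2 * n)) → EuclideanSpace ℝ (Fin n) →L[ℝ] ℝ :=
    fun z => (σ.inChart v z).comp (B.liftMinusInCharts v z)
  have hμ : DifferentiableAt ℝ μ (φ v) :=
    ((hσ.contDiffAt_inChart hz₀.1.1).differentiableAt (by simp)).clm_comp
      ((B.differentiableAt_inverse_TbothInCharts hz₀).clm_comp (differentiableAt_const _))
  have hμ' : ∀ z ∈ B.chartDomain v, ∀ w, μ z w = σ (φ.symm z) (B.liftMinus (φ.symm z)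
      (chartSymmD (B.minus v) (extChartAt (𝓡 n) (B.minus v) (B.minus (φ.symm z))) w)) := by
    intro z hz w
    rw [← B.chartSymmD_liftMinusInCharts hz]
    rfl
  have hid : ∀ a : EuclideanSpace ℝ (Fin (2 * n)), chartD v v a = a := fun a =>
    congrArg (fun L : EuclideanSpace ℝ (Fin (2 * n)) →L[ℝ] EuclideanSpace ℝ (Fin (2 * n)) => L a)
      chartD_self
  have hidQ : ∀ a : EuclideanSpace ℝ (Fin n), chartD (B.minus v) (B.minus v) a = a := fun a =>
    congrArg (fun L : EuclideanSpace ℝ (Fin n) →L[ℝ] EuclideanSpace ℝ (Fin n) => L a) chartD_self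
  have hθ : (-(B.thetaMinus σ).inChart v) =ᶠ[𝓝 (φ v)]
      fun z => (μ z).comp (fderiv ℝ (inCharts B.minus v) z) := by
    filter_upwards [B.chartDomain_mem_nhds v] with z hz
    ext u
    change -(-σ (φ.symm z) (B.liftMinus (φ.symm z) (B.Tminus (φ.symm z) (chartSymmD v z u)))) =
      μ z (fderiv ℝ (inCharts B.minus v) z u)
    rw [hμ' z hz, B.fderiv_minus_inCharts hz, neg_neg]
    exact congrArg (fun w => σ (φ.symm z) (B.liftMinus (φ.symm z) w))
      (chartSymmD_chartD hz.2.2 _).symm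
  obtain ⟨hd, hd'⟩ := fderiv_comp_fderiv_antisymm hμ
    (contDiffAt_inCharts B.submersion_minus.contMDiff hz₀.2) hθ
  have hT : ∀ a : TangentSpace (𝓡 (2 * n)) v,
      fderiv ℝ (inCharts B.minus v) (φ v) a = B.Tminus v a := by
    intro a
    have h1 := fderiv_inCharts_apply B.submersion_minus.contMDiff hz₀.2 a
    have h2 := chartSymmD_chartD (mem_extChartAt_source (I := 𝓡 (2 * n)) v) a
    have h3 : chartSymmD v (φ v) a = a := by
      conv_rhs => rw [← h2]
      exact congrArg (chartSymmD v (φ v)) (hid a).symm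
    rw [h1, h3, ← hφ, φ.left_inv (mem_extChartAt_source v)]
    exact hidQ _
  have hd'' : ∀ a b : EuclideanSpace ℝ (Fin (2 * n)),
      fderiv ℝ ((B.thetaMinus σ).inChart v) (φ v) a b -
        fderiv ℝ ((B.thetaMinus σ).inChart v) (φ v) b a =
      fderiv ℝ μ (φ v) b (fderiv ℝ (inCharts B.minus v) (φ v) a) -
        fderiv ℝ μ (φ v) a (fderiv ℝ (inCharts B.minus v) (φ v) b) := by
    intro a b
    have h1 := hd' a b
    rw [fderiv_neg] at h1
    simp only [neg_apply] at h1
    linarith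
  have hg : ∀ a : EuclideanSpace ℝ (Fin n), HasFDerivAt (fun z => μ z a)
      ((ContinuousLinearMap.apply ℝ ℝ a).comp (fderiv ℝ μ (φ v))) (φ v) := fun a =>
    (ContinuousLinearMap.apply ℝ ℝ a).hasFDerivAt.comp (φ v) hμ.hasFDerivAt
  refine ⟨differentiableAt_neg_iff.1 hd, fderiv ℝ μ (φ v), fun a b => ?_, fun a c => ?_⟩
  · refine ((B.thetaMinus σ).d_eq v a b).trans ((hd'' a b).trans ?_)
    rw [hT, hT]
  · have hg' := HasMFDerivAt.comp v (hg a).hasMFDerivAt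
      (hasMFDerivAt_chart (mem_extChartAt_source (I := 𝓡 (2 * n)) v))
    -- The field used in `dpm` lifts a field that is constant in the chart, so the function being
    -- differentiated is `z ↦ μ z a`.
    have hev : (fun x => σ x (B.liftMinus x (extendVector (B.minus v) a (B.minus x)))) =ᶠ[𝓝 v]
        (fun z => μ z a) ∘ φ := by
      have h1 : ∀ᶠ x in 𝓝 v, φ x ∈ B.chartDomain v :=
        (continuousAt_extChartAt v).eventually (B.chartDomain_mem_nhds v)
      filter_upwards [h1, extChartAt_source_mem_nhds (I := 𝓡 (2 * n)) v] with x hx hxs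
      refine Eq.trans ?_ (hμ' (φ x) hx a).symm
      rw [φ.left_inv hxs]
      exact congrArg (fun w => σ x (B.liftMinus x (chartSymmD (B.minus v)
        (extChartAt (𝓡 n) (B.minus v) (B.minus x)) w))) (hidQ a)
    have h2 := (hg'.congr_of_eventuallyEq hev).mfderiv
    have h3 : B.dpm σ v a c = fderiv ℝ μ (φ v) (chartD v v (B.liftPlus v c)) a :=
      congrArg (fun L : EuclideanSpace ℝ (Fin (2 * n)) →L[ℝ] ℝ => L (B.liftPlus v c)) h2
    rw [h3]
    exact congrArg (fun w => fderiv ℝ μ (φ v) w a) (hid _)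

/-- The exterior derivative of `θ⁺` in charts. -/
theorem exists_thetaPlus_d_eq {σ : OneForm (2 * n) V} (hσ : σ.IsSmooth) (v : V) :
    DifferentiableAt ℝ ((B.thetaPlus σ).inChart v) (extChartAt (𝓡 (2 * n)) v v) ∧
    ∃ A : EuclideanSpace ℝ (Fin (2 * n)) →L[ℝ] EuclideanSpace ℝ (Fin n) →L[ℝ] ℝ,
      (∀ a b : TangentSpace (𝓡 (2 * n)) v, (B.thetaPlus σ).d v a b =
        A a (B.Tplus v b) - A b (B.Tplus v a)) := by
  set φ := extChartAt (𝓡 (2 * n)) v with hφ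
  have hz₀ := mem_of_mem_nhds (B.chartDomain_mem_nhds v)
  let μ : EuclideanSpace ℝ (Fin (2 * n)) → EuclideanSpace ℝ (Fin n) →L[ℝ] ℝ :=
    fun z => (σ.inChart v z).comp (B.liftPlusInCharts v z)
  have hμ : DifferentiableAt ℝ μ (φ v) :=
    ((hσ.contDiffAt_inChart hz₀.1.1).differentiableAt (by simp)).clm_comp
      ((B.differentiableAt_inverse_TbothInCharts hz₀).clm_comp (differentiableAt_const _))
  have hμ' : ∀ z ∈ B.chartDomain v, ∀ w, μ z w = σ (φ.symm z) (B.liftPlus (φ.symm z)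
      (chartSymmD (B.plus v) (extChartAt (𝓡 n) (B.plus v) (B.plus (φ.symm z))) w)) := by
    intro z hz w
    rw [← B.chartSymmD_liftPlusInCharts hz]
    rfl
  have hid : ∀ a : EuclideanSpace ℝ (Fin (2 * n)), chartD v v a = a := fun a =>
    congrArg (fun L : EuclideanSpace ℝ (Fin (2 * n)) →L[ℝ] EuclideanSpace ℝ (Fin (2 * n)) => L a)
      chartD_self
  have hidQ : ∀ a : EuclideanSpace ℝ (Fin n), chartD (B.plus v) (B.plus v) a = a := fun a =>
    congrArg (fun L : EuclideanSpace ℝ (Fin n) →L[ℝ] EuclideanSpace ℝ (Fin n) => L a) chartD_self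
  have hθ : (B.thetaPlus σ).inChart v =ᶠ[𝓝 (φ v)]
      fun z => (μ z).comp (fderiv ℝ (inCharts B.plus v) z) := by
    filter_upwards [B.chartDomain_mem_nhds v] with z hz
    ext u
    change σ (φ.symm z) (B.liftPlus (φ.symm z) (B.Tplus (φ.symm z) (chartSymmD v z u))) =
      μ z (fderiv ℝ (inCharts B.plus v) z u)
    rw [hμ' z hz, B.fderiv_plus_inCharts hz]
    exact congrArg (fun w => σ (φ.symm z) (B.liftPlus (φ.symm z) w))
      (chartSymmD_chartD hz.1.2 _).symm
  obtain ⟨hd, hd'⟩ := fderiv_comp_fderiv_antisymm hμ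
    (contDiffAt_inCharts B.submersion_plus.contMDiff hz₀.1) hθ
  have hT : ∀ a : TangentSpace (𝓡 (2 * n)) v,
      fderiv ℝ (inCharts B.plus v) (φ v) a = B.Tplus v a := by
    intro a
    have h1 := fderiv_inCharts_apply B.submersion_plus.contMDiff hz₀.1 a
    have h2 := chartSymmD_chartD (mem_extChartAt_source (I := 𝓡 (2 * n)) v) a
    have h3 : chartSymmD v (φ v) a = a := by
      conv_rhs => rw [← h2]
      exact congrArg (chartSymmD v (φ v)) (hid a).symm
    rw [h1, h3, ← hφ, φ.left_inv (mem_extChartAt_source v)]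
    exact hidQ _
  refine ⟨hd, fderiv ℝ μ (φ v), fun a b => ?_⟩
  refine ((B.thetaPlus σ).d_eq v a b).trans ?_
  have h1 := hd' a b
  rwa [hT, hT] at h1

variable {σ : OneForm (2 * n) V}

theorem omegaPlus_eq_omegaMinus (hσ : σ.IsSmooth) (hcl : ∀ (v : V) a b, σ.d v a b = 0) (v : V)
    (a b : TangentSpace (𝓡 (2 * n)) v) : B.omegaPlus σ v a b = B.omegaMinus σ v a b := by
  obtain ⟨hd, -⟩ := B.exists_thetaMinus_d_eq hσ v
  have hd' : DifferentiableAt ℝ (σ.inChart v) (extChartAt (𝓡 (2 * n)) v v) :=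
    (hσ.contDiffAt_inChart (mem_extChartAt_target v)).differentiableAt (by simp)
  have hsum : (B.thetaPlus σ).inChart v = (B.thetaMinus σ).inChart v + σ.inChart v := by
    funext z
    simp only [OneForm.inChart, Pi.add_apply, B.thetaPlus_eq]
    exact ContinuousLinearMap.add_comp _ _ _
  have hadd : ∀ a b : EuclideanSpace ℝ (Fin (2 * n)),
      (B.thetaPlus σ).d v a b = (B.thetaMinus σ).d v a b + σ.d v a b := by
    intro a b
    rw [OneForm.d_eq, OneForm.d_eq, OneForm.d_eq, hsum, fderiv_add hd hd']
    simp only [add_apply]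
    ring
  rw [omegaPlus, omegaMinus, hadd a b, hcl, add_zero]

/-- The discrete two-form in terms of `d^±σ`. -/
theorem omegaPlus_eq_dpm (hσ : σ.IsSmooth) (hcl : ∀ (v : V) a b, σ.d v a b = 0) (v : V)
    (a b : TangentSpace (𝓡 (2 * n)) v) : B.omegaPlus σ v a b =
      B.dpm σ v (B.Tminus v b) (B.Tplus v a) - B.dpm σ v (B.Tminus v a) (B.Tplus v b) := by
  obtain ⟨-, A, hA, hdpm⟩ := B.exists_thetaMinus_d_eq hσ v
  obtain ⟨-, A', hA'⟩ := B.exists_thetaPlus_d_eq hσ v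
  have hm : ∀ a b, B.omegaPlus σ v a b = A a (B.Tminus v b) - A b (B.Tminus v a) := by
    intro a b
    rw [B.omegaPlus_eq_omegaMinus hσ hcl, omegaMinus, hA]
    exact neg_sub _ _
  -- The formula for `dθ⁺` shows that `ω` vanishes on pairs in `vert⁺`. Hence the `vert⁺` parts of
  -- `a` and `b` cancel in `hm`, and only `A` on the lifts through `∂⁺`, that is `d^±σ`, remains.
  have h0 : B.omegaPlus σ v (B.liftMinus v (B.Tminus v a)) (B.liftMinus v (B.Tminus v b)) = 0 := by
    rw [omegaPlus, hA', B.Tplus_liftMinus, B.Tplus_liftMinus]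
    exact (congrArg Neg.neg (sub_eq_zero.2 ((map_zero _).trans (map_zero _).symm))).trans neg_zero
  rw [hm, B.Tminus_liftMinus, B.Tminus_liftMinus] at h0
  have hsplit : ∀ a w, A a w = A (B.liftPlus v (B.Tplus v a)) w +
      A (B.liftMinus v (B.Tminus v a)) w := by
    intro a w
    have := congrArg (fun x => A x w) (B.liftPlus_add_liftMinus v a).symm
    refine this.trans ?_
    exact congrArg (fun L : EuclideanSpace ℝ (Fin n) →L[ℝ] ℝ => L w) (map_add A _ _)
  rw [hm, hdpm, hdpm]
  have h1 := hsplit a (B.Tminus v b)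
  have h2 := hsplit b (B.Tminus v a)
  linarith

theorem dpm_zero_left (hσ : σ.IsSmooth) (v : V) (c) : B.dpm σ v 0 c = 0 := by
  obtain ⟨-, A, -, h⟩ := B.exists_thetaMinus_d_eq hσ v
  rw [h]
  exact map_zero _

theorem dpm_zero_right (hσ : σ.IsSmooth) (v : V) (a) : B.dpm σ v a 0 = 0 := by
  obtain ⟨-, A, -, h⟩ := B.exists_thetaMinus_d_eq hσ v
  rw [h, map_zero]
  exact congrArg (fun L : EuclideanSpace ℝ (Fin n) →L[ℝ] ℝ => L a) (map_zero A)

end DiscreteTangentBundle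

end Forms

/-! ### Curves in the fibres of submersions -/

section FibreCurves

/-- Every tangent vector of a regular level set is the velocity of a curve in this level set. -/
theorem exists_curve_of_hasStrictFDerivAt {E G : Type*} [NormedAddCommGroup E] [NormedSpace ℝ E]
    [CompleteSpace E] [NormedAddCommGroup G] [NormedSpace ℝ G] [FiniteDimensional ℝ G] {f : E → G}
    {f' : E →L[ℝ] G} {a u : E} (hf : HasStrictFDerivAt f f' a) (hf' : Function.Surjective f')
    (hu : f' u = 0) :
    ∃ α : ℝ → E, α 0 = a ∧ HasFDerivAt α (ContinuousLinearMap.toSpanSingleton ℝ u) 0 ∧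
      ∀ᶠ s in 𝓝 0, ContinuousAt α s ∧ f (α s) = f a := by
  have hr : f'.range = ⊤ := LinearMap.range_eq_top.2 hf'
  let w : f'.ker := ⟨u, hu⟩
  have hl : HasFDerivAt (fun s : ℝ => s • w) (ContinuousLinearMap.toSpanSingleton ℝ w) 0 :=
    (ContinuousLinearMap.toSpanSingleton ℝ w).hasFDerivAt
  have hc : Continuous (fun s : ℝ => ((f a, s • w) : G × f'.ker)) := by fun_prop
  have ht : Filter.Tendsto (fun s : ℝ => ((f a, s • w) : G × f'.ker)) (𝓝 0) (𝓝 (f a, 0)) := by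
    simpa using hc.tendsto 0
  set e := hf.implicitToOpenPartialHomeomorph f f' hr with he
  -- The implicit function at the fixed value `f a`, restricted to the line spanned by `u` in the
  -- kernel.
  refine ⟨fun s => hf.implicitFunction f f' hr (f a) (s • w), ?_, ?_, ?_⟩
  · simp
  · have h1 : HasFDerivAt (hf.implicitFunction f f' hr (f a)) f'.ker.subtypeL ((0 : ℝ) • w) := by
      rw [zero_smul]; exact (hf.to_implicitFunction hr).hasFDerivAt
    refine (h1.comp (0 : ℝ) hl).congr_fderiv ?_
    ext
    simp [w]
  · have h2 := ht.eventually (e.open_target.mem_nhds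
      (hf.mem_implicitToOpenPartialHomeomorph_target hr))
    filter_upwards [h2, ht.eventually (hf.map_implicitFunction_eq hr)] with s hs hs'
    exact ⟨(e.continuousAt_symm hs).comp (f := fun s : ℝ => ((f a, s • w) : G × f'.ker))
      hc.continuousAt, hs'⟩

variable {m n : ℕ}
  {M : Type*} [TopologicalSpace M] [ChartedSpace (EuclideanSpace ℝ (Fin m)) M]
  {Q : Type*} [TopologicalSpace Q] [ChartedSpace (EuclideanSpace ℝ (Fin n)) Q]
  [IsManifold (𝓡 m) ∞ M] [IsManifold (𝓡 n) ∞ Q]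

/-- Every vertical tangent vector of a submersion is the velocity of a curve in a fibre. -/
theorem IsSmoothSubmersion.exists_curve {f : M → Q} (hf : IsSmoothSubmersion (m := m) (n := n) f)
    {x : M} {u : TangentSpace (𝓡 m) x} (hu : mfderiv (𝓡 m) (𝓡 n) f x u = 0) :
    ∃ (γ : ℝ → M) (v : ℝ →L[ℝ] EuclideanSpace ℝ (Fin m)), γ 0 = x ∧ v 1 = u ∧
      HasMFDerivAt 𝓘(ℝ, ℝ) (𝓡 m) γ 0 v ∧ ∀ᶠ s in 𝓝 0, ContinuousAt γ s ∧ f (γ s) = f x := by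
  have hz := inChartsDomain_mem_nhds (m := m) (n := n)
    (hf.contMDiff.continuous.continuousAt (x := x))
  have hz₀ := mem_of_mem_nhds hz
  have hxs := mem_extChartAt_source (I := 𝓡 m) x
  have hid : ∀ a : EuclideanSpace ℝ (Fin m),
      chartSymmD x (extChartAt (𝓡 m) x x) a = a := by
    intro a
    have h2 := chartSymmD_chartD hxs a
    conv_rhs => rw [← h2]
    exact congrArg (chartSymmD x (extChartAt (𝓡 m) x x))
      (congrArg (fun L : EuclideanSpace ℝ (Fin m) →L[ℝ] EuclideanSpace ℝ (Fin m) => L a)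
        chartD_self).symm
  have hfd : ∀ a : EuclideanSpace ℝ (Fin m),
      fderiv ℝ (inCharts (n := n) f x) (extChartAt (𝓡 m) x x) a =
        mfderiv (𝓡 m) (𝓡 n) f x a := by
    intro a
    rw [fderiv_inCharts_apply hf.contMDiff hz₀ a, hid, extChartAt_to_inv]
    exact congrArg (fun L : EuclideanSpace ℝ (Fin n) →L[ℝ] EuclideanSpace ℝ (Fin n) =>
      L (mfderiv (𝓡 m) (𝓡 n) f x a)) chartD_self
  have hst := (contDiffAt_inCharts hf.contMDiff hz₀).hasStrictFDerivAt (by simp)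
  obtain ⟨α, hα0, hα, hαf⟩ := exists_curve_of_hasStrictFDerivAt
    (E := EuclideanSpace ℝ (Fin m)) (u := u) hst
    (fun b => by
      obtain ⟨a, ha⟩ := hf.surjective x b
      exact ⟨a, (hfd a).trans ha⟩) ((hfd u).trans hu)
  have hφ : extChartAt (𝓡 m) x x ∈ (extChartAt (𝓡 m) x).target := hz₀.1
  have hαc : ContinuousAt α 0 := hα.continuousAt
  have hα0t : Filter.Tendsto α (𝓝 0) (𝓝 (extChartAt (𝓡 m) x x)) := by
    rw [← hα0]; exact hαc
  refine ⟨fun s => (extChartAt (𝓡 m) x).symm (α s),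
    (chartSymmD x (α 0)).comp (ContinuousLinearMap.toSpanSingleton ℝ u), ?_, ?_, ?_, ?_⟩
  · simp only [hα0, extChartAt_to_inv]
  · rw [hα0]
    refine (hid _).trans ?_
    exact one_smul ℝ u
  · have h1 : HasMFDerivAt 𝓘(ℝ, EuclideanSpace ℝ (Fin m)) (𝓡 m) (extChartAt (𝓡 m) x).symm (α 0)
        (chartSymmD x (α 0)) := hasMFDerivAt_chart_symm (by rwa [hα0])
    exact HasMFDerivAt.comp 0 h1 hα.hasMFDerivAt
  · filter_upwards [hαf, hα0t.eventually hz] with s hs hsz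
    refine ⟨ContinuousAt.comp (f := α) (continuousAt_extChartAt_symm'' hsz.1) hs.1, ?_⟩
    refine (extChartAt (𝓡 n) (f x)).injOn hsz.2 (mem_extChartAt_source _) (hs.2.trans ?_)
    exact congrArg (fun y => extChartAt (𝓡 n) (f x) (f y)) (extChartAt_to_inv x)

variable {F : ∀ q : Q, Submodule ℝ (TangentSpace (𝓡 n) q)} {r : ℕ}

theorem IsDistribution.finrank_eq (hd : IsDistribution F r) (q : Q) :
    Module.finrank ℝ (F q) = r := by
  obtain ⟨U, -, hq, s, -, hs⟩ := hd q
  obtain ⟨hli, hspan⟩ := hs q hq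
  rw [← hspan]
  exact (finrank_span_eq_card hli).trans (Fintype.card_fin r)

variable [SecondCountableTopology Q]

/-- If `f x` and `g x` lie in the same leaf of `F` for all `x`, then `Tg` maps `ker Tf` to `F`. -/
theorem mfderiv_mem_of_reachable (hd : IsDistribution F r) (hF : IsInvolutive F) {f g : M → Q}
    (hf : IsSmoothSubmersion (m := m) (n := n) f) (hg : ContMDiff (𝓡 m) (𝓡 n) ∞ g)
    (hr : ∀ x, Reachable F (f x) (g x) ∨ Reachable F (g x) (f x)) {x : M}
    {u : TangentSpace (𝓡 m) x} (hu : mfderiv (𝓡 m) (𝓡 n) f x u = 0) :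
    mfderiv (𝓡 m) (𝓡 n) g x u ∈ F (g x) := by
  obtain ⟨γ, v, hγ0, hv1, hγ, hs⟩ := hf.exists_curve hu
  subst hγ0
  subst hv1
  have hgd := (hg.mdifferentiableAt (by simp) :
    MDifferentiableAt (𝓡 m) (𝓡 n) g (γ 0)).hasMFDerivAt
  -- Along `γ` the map `f` keeps the value `f (γ 0)`, so `g ∘ γ` stays in the leaf of that point.
  refine tangent_of_reachable (q := f (γ 0)) hd hF (HasMFDerivAt.comp 0 hgd hγ) ?_ ?_
  · filter_upwards [hs] with s hs
    exact hg.continuous.continuousAt.comp hs.1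
  · filter_upwards [hs] with s hs
    rw [← hs.2]
    exact hr (γ s)

/-- If `f x` and `g x` lie in the same leaf of `F` for all `x` and `Tf` and `Tg` are jointly
injective, then `Tg` maps `ker Tf` onto `F`. -/
theorem exists_mfderiv_eq_of_reachable (hd : IsDistribution F r) (hF : IsInvolutive F)
    {f g : M → Q} (hf : IsSmoothSubmersion (m := m) (n := n) f) (hg : ContMDiff (𝓡 m) (𝓡 n) ∞ g)
    (hr : ∀ x, Reachable F (f x) (g x) ∨ Reachable F (g x) (f x)) (hm : m = n + r) {x : M}
    (hinj : ∀ u, mfderiv (𝓡 m) (𝓡 n) f x u = 0 → mfderiv (𝓡 m) (𝓡 n) g x u = 0 → u = 0)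
    {w : TangentSpace (𝓡 n) (g x)} (hw : w ∈ F (g x)) :
    ∃ u, mfderiv (𝓡 m) (𝓡 n) f x u = 0 ∧ mfderiv (𝓡 m) (𝓡 n) g x u = w := by
  let A : EuclideanSpace ℝ (Fin m) →ₗ[ℝ] EuclideanSpace ℝ (Fin n) :=
    (mfderiv (𝓡 m) (𝓡 n) f x).toLinearMap
  let B : EuclideanSpace ℝ (Fin m) →ₗ[ℝ] EuclideanSpace ℝ (Fin n) :=
    (mfderiv (𝓡 m) (𝓡 n) g x).toLinearMap
  let S : Submodule ℝ (EuclideanSpace ℝ (Fin n)) := F (g x)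
  have hle : A.ker.map B ≤ S := by
    rintro _ ⟨u, hu, rfl⟩
    exact mfderiv_mem_of_reachable hd hF hf hg hr hu
  -- `Tf` is onto, so its kernel has dimension `m - n = r`. `Tg` is injective there, so the image
  -- has the rank of `F`, and inclusion becomes equality.
  have hker : Module.finrank ℝ A.ker = r := by
    have h1 := A.finrank_range_add_finrank_ker
    have h2 : A.range = ⊤ := LinearMap.range_eq_top.2 (hf.surjective x)
    rw [h2, finrank_top] at h1
    simp only [finrank_euclideanSpace, Fintype.card_fin] at h1
    omega
  have hinj' : ∀ u : EuclideanSpace ℝ (Fin m), A u = 0 → B u = 0 → u = 0 := hinj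
  have hmap : Module.finrank ℝ (A.ker.map B) = r := by
    rw [← hker]
    refine (LinearEquiv.finrank_eq (LinearEquiv.ofBijective (B.submoduleMap A.ker) ⟨?_, ?_⟩)).symm
    · rw [← LinearMap.ker_eq_bot, LinearMap.ker_eq_bot']
      intro y hy
      exact Subtype.ext (hinj' y y.2 (congrArg Subtype.val hy))
    · exact B.submoduleMap_surjective A.ker
  have heq := Submodule.eq_of_le_of_finrank_eq hle (hmap.trans (hd.finrank_eq (g x)).symm)
  have hw' : w ∈ A.ker.map B := heq ▸ hw
  obtain ⟨u, hu, huw⟩ := hw'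
  exact ⟨u, hu, huw⟩

end FibreCurves

/-! ### Holonomic systems -/

section Holonomic

variable {n k r : ℕ} {V Q D : Type*}
  [TopologicalSpace Q] [ChartedSpace (EuclideanSpace ℝ (Fin n)) Q]
  [TopologicalSpace V] [ChartedSpace (EuclideanSpace ℝ (Fin (2 * n))) V]
  [IsManifold (𝓡 (2 * n)) ∞ V]
  [TopologicalSpace D] [ChartedSpace (EuclideanSpace ℝ (Fin k)) D]

/-- Removes the transport from `T_{∂⁺(v)}Q` to `T_{∂⁻(ṽ)}Q` that occurs in `RegularPlus`. -/
theorem forall_mem_cast_iff {F : ∀ q : Q, Submodule ℝ (TangentSpace (𝓡 n) q)} {p q : Q}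
    (h : p = q) {E : Submodule ℝ (TangentSpace (𝓡 n) p)} (hE : E = F p)
    (P : TangentSpace (𝓡 n) q → Prop) : (∀ a ∈ E, P (h ▸ a)) ↔ ∀ a ∈ F q, P a := by
  subst h
  subst hE
  rfl

namespace DCLS

variable [IsManifold (𝓡 n) ∞ Q] (C : DCLS n V Q k D)

theorem mfderiv_plus_incl (x : D) (u : TangentSpace (𝓡 k) x) :
    mfderiv (𝓡 k) (𝓡 n) (C.plus ∘ C.incl) x u =
      C.Tplus (C.incl x) (mfderiv (𝓡 k) (𝓡 (2 * n)) C.incl x u) := by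
  have h1 := C.submersion_plus.contMDiff.mdifferentiableAt (x := C.incl x) (by simp)
  have h2 := C.embedding_incl.contMDiff.mdifferentiableAt (x := x) (by simp)
  rw [mfderiv_comp x h1 h2]
  rfl

theorem mfderiv_minus_incl (x : D) (u : TangentSpace (𝓡 k) x) :
    mfderiv (𝓡 k) (𝓡 n) (C.minus ∘ C.incl) x u =
      C.Tminus (C.incl x) (mfderiv (𝓡 k) (𝓡 (2 * n)) C.incl x u) := by
  have h1 := C.submersion_minus.contMDiff.mdifferentiableAt (x := C.incl x) (by simp)
  have h2 := C.embedding_incl.contMDiff.mdifferentiableAt (x := x) (by simp)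
  rw [mfderiv_comp x h1 h2]
  rfl

theorem eq_zero_of_mfderiv_eq_zero (x : D) (u : TangentSpace (𝓡 k) x)
    (hp : mfderiv (𝓡 k) (𝓡 n) (C.plus ∘ C.incl) x u = 0)
    (hm : mfderiv (𝓡 k) (𝓡 n) (C.minus ∘ C.incl) x u = 0) : u = 0 := by
  rw [mfderiv_plus_incl] at hp
  rw [mfderiv_minus_incl] at hm
  have h := C.ker_inf_ker _ _ hp hm
  exact C.embedding_incl.injective x (h.trans (map_zero _).symm)

variable {C} {F : ∀ q : Q, Submodule ℝ (TangentSpace (𝓡 n) q)}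

theorem liftMinus_mem_K0 {v : V} {a} (ha : a ∈ F (C.minus v)) : C.liftMinus v a ∈ C.K0 F v := by
  refine ⟨?_, ?_⟩
  · change C.Tminus v (C.liftMinus v a) ∈ F (C.minus v)
    rwa [C.Tminus_liftMinus]
  · change C.Tplus v (C.liftMinus v a) ∈ F (C.plus v)
    rw [C.Tplus_liftMinus]
    exact zero_mem _

theorem liftPlus_mem_K0 {v : V} {b} (hb : b ∈ F (C.plus v)) : C.liftPlus v b ∈ C.K0 F v := by
  refine ⟨?_, ?_⟩
  · change C.Tminus v (C.liftPlus v b) ∈ F (C.minus v)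
    rw [C.Tminus_liftPlus]
    exact zero_mem _
  · change C.Tplus v (C.liftPlus v b) ∈ F (C.plus v)
    rwa [C.Tplus_liftPlus]

variable [IsManifold (𝓡 k) ∞ D] [SecondCountableTopology Q]

/-- Along a fibre of `∂⁺|𝒟` the point `∂⁻` moves in one leaf of `F`; the dimension of `𝒟` turns the
resulting inclusion into an equality. -/
theorem IsHolonomic.map_Tminus (hC : C.IsHolonomic F r) (x : D) :
    (C.vertPlus (C.incl x) ⊓ C.tangentD x).map (C.Tminus (C.incl x)).toLinearMap =
      F (C.minus (C.incl x)) := by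
  refine le_antisymm ?_ fun w hw => ?_
  · rintro _ ⟨_, ⟨h1, u, rfl⟩, rfl⟩
    have h2 := mfderiv_mem_of_reachable hC.distribution hC.involutive C.submersion_plus_incl
      C.submersion_minus_incl.contMDiff (fun x => Or.inr (hC.reachable x))
      ((C.mfderiv_plus_incl x u).trans h1)
    rw [mfderiv_minus_incl] at h2
    exact h2
  · obtain ⟨u, h1, h2⟩ := exists_mfderiv_eq_of_reachable hC.distribution hC.involutive
      C.submersion_plus_incl C.submersion_minus_incl.contMDiff (fun x => Or.inr (hC.reachable x))
      hC.dim_eq (C.eq_zero_of_mfderiv_eq_zero x) hw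
    exact ⟨_, ⟨(C.mfderiv_plus_incl x u).symm.trans h1, u, rfl⟩,
      (C.mfderiv_minus_incl x u).symm.trans h2⟩

theorem IsHolonomic.map_Tplus (hC : C.IsHolonomic F r) (x : D) :
    (C.vertMinus (C.incl x) ⊓ C.tangentD x).map (C.Tplus (C.incl x)).toLinearMap =
      F (C.plus (C.incl x)) := by
  refine le_antisymm ?_ fun w hw => ?_
  · rintro _ ⟨_, ⟨h1, u, rfl⟩, rfl⟩
    have h2 := mfderiv_mem_of_reachable hC.distribution hC.involutive C.submersion_minus_incl
      C.submersion_plus_incl.contMDiff (fun x => Or.inl (hC.reachable x))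
      ((C.mfderiv_minus_incl x u).trans h1)
    rw [mfderiv_plus_incl] at h2
    exact h2
  · obtain ⟨u, h1, h2⟩ := exists_mfderiv_eq_of_reachable hC.distribution hC.involutive
      C.submersion_minus_incl C.submersion_plus_incl.contMDiff (fun x => Or.inl (hC.reachable x))
      hC.dim_eq (fun u hm hp => C.eq_zero_of_mfderiv_eq_zero x u hp hm) hw
    exact ⟨_, ⟨(C.mfderiv_minus_incl x u).symm.trans h1, u, rfl⟩,
      (C.mfderiv_plus_incl x u).symm.trans h2⟩

theorem IsHolonomic.regularMinus_iff (hC : C.IsHolonomic F r)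
    (hpred : ∀ x' : D, ∃ x : D, C.plus (C.incl x) = C.minus (C.incl x')) :
    C.RegularMinus ↔ ∀ x : D, ∀ a ∈ F (C.minus (C.incl x)),
      (∀ b ∈ F (C.plus (C.incl x)), C.dpm C.σ (C.incl x) a b = 0) → a = 0 := by
  refine ⟨fun h x => ?_, fun h y x _ => ?_⟩
  · obtain ⟨y, hy⟩ := hpred x
    have := h y x hy
    rwa [hC.map_Tminus, hC.E_eq] at this
  · rw [hC.map_Tminus, hC.E_eq]
    exact h x

/-- The predecessor `v` enters only through `ℰ_v`, the fibre of `F` at `∂⁺(v) = ∂⁻(ṽ)`. Since one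
always exists, the condition concerns `ṽ` alone. -/
theorem IsHolonomic.regularPlus_iff (hC : C.IsHolonomic F r)
    (hpred : ∀ x' : D, ∃ x : D, C.plus (C.incl x) = C.minus (C.incl x')) :
    C.RegularPlus ↔ ∀ x : D, ∀ b ∈ F (C.plus (C.incl x)),
      (∀ a ∈ F (C.minus (C.incl x)), C.dpm C.σ (C.incl x) a b = 0) → b = 0 := by
  refine ⟨fun h x b hb hab => ?_, fun h y x hy b hb hab => ?_⟩
  · obtain ⟨y, hy⟩ := hpred x
    exact h y x hy b (by rwa [hC.map_Tplus])
      ((forall_mem_cast_iff hy (hC.E_eq y) (fun a => C.dpm C.σ (C.incl x) a b = 0)).2 hab)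
  · rw [hC.map_Tplus] at hb
    exact h x b hb
      ((forall_mem_cast_iff hy (hC.E_eq y) (fun a => C.dpm C.σ (C.incl x) a b = 0)).1 hab)

/-- A bilinear form `d^±σ` without left and right kernel on `F × F` amounts to a nondegenerate
two-form `ω`. -/
theorem IsHolonomic.regular_iff (hC : C.IsHolonomic F r)
    (hpred : ∀ x' : D, ∃ x : D, C.plus (C.incl x) = C.minus (C.incl x')) :
    C.Regular ↔ C.NondegenerateOnK0 F (C.omegaPlus C.σ) := by
  have hω := fun v => C.omegaPlus_eq_dpm C.smooth_σ hC.closed v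
  have h0l := fun v => C.dpm_zero_left C.smooth_σ v
  have h0r := fun v => C.dpm_zero_right C.smooth_σ v
  rw [Regular, hC.regularMinus_iff hpred, hC.regularPlus_iff hpred]
  constructor
  · rintro ⟨hm, hp⟩ x δv hδ hv
    -- Testing `ω` against lifts through `∂⁻` isolates `T∂⁺δv` as an element of the right kernel of
    -- `d^±σ`; lifts through `∂⁺` isolate `T∂⁻δv` in the left kernel.
    have h1 : C.Tplus (C.incl x) δv = 0 := by
      refine hp x _ hδ.2 fun a ha => ?_
      have h := hv _ (liftMinus_mem_K0 ha)
      rwa [hω, C.Tminus_liftMinus, C.Tplus_liftMinus, h0r, sub_zero] at h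
    have h2 : C.Tminus (C.incl x) δv = 0 := by
      refine hm x _ hδ.1 fun b hb => ?_
      have h := hv _ (liftPlus_mem_K0 hb)
      rwa [hω, C.Tminus_liftPlus, C.Tplus_liftPlus, h0l, zero_sub, neg_eq_zero] at h
    exact C.ker_inf_ker _ _ h1 h2
  -- Conversely, the lift of a vector in the left or right kernel of `d^±σ` lies in the kernel of
  -- `ω` on `𝒦⁰`.
  · refine fun h => ⟨fun x a ha hab => ?_, fun x b hb hab => ?_⟩
    · have h1 := h x _ (liftMinus_mem_K0 ha) fun δw hw => by
        rw [hω, C.Tminus_liftMinus, C.Tplus_liftMinus, h0r, hab (C.Tplus _ δw) hw.2, sub_zero]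
      rw [← C.Tminus_liftMinus _ a, h1]
      exact map_zero _
    · have h1 := h x _ (liftPlus_mem_K0 hb) fun δw hw => by
        rw [hω, C.Tminus_liftPlus, C.Tplus_liftPlus, h0l, hab (C.Tminus _ δw) hw.1, sub_zero]
      rw [← C.Tplus_liftPlus _ b, h1]
      exact map_zero _

end DCLS

end Holonomic

end DiscreteMechanics
end

theorem mainTheorem7 {n k r : ℕ} {V Q D : Type*}
    [TopologicalSpace Q] [T2Space Q] [SecondCountableTopology Q]
    [ChartedSpace (EuclideanSpace ℝ (Fin n)) Q] [IsManifold (𝓡 n) ∞ Q]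
    [TopologicalSpace V] [T2Space V] [SecondCountableTopology V]
    [ChartedSpace (EuclideanSpace ℝ (Fin (2 * n))) V] [IsManifold (𝓡 (2 * n)) ∞ V]
    [TopologicalSpace D] [ChartedSpace (EuclideanSpace ℝ (Fin k)) D] [IsManifold (𝓡 k) ∞ D]
    (C : DiscreteMechanics.DCLS n V Q k D)
    (F : ∀ q : Q, Submodule ℝ (TangentSpace (𝓡 n) q))
    (hC : C.IsHolonomic F r)
    (hpred : ∀ x' : D, ∃ x : D, C.plus (C.incl x) = C.minus (C.incl x')) :
    (∀ (v : V) (δv δw : TangentSpace (𝓡 (2 * n)) v),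
      C.omegaPlus C.σ v δv δw = C.omegaMinus C.σ v δv δw) ∧
    (C.Regular ↔ C.NondegenerateOnK0 F (C.omegaPlus C.σ)) :=
  ⟨C.omegaPlus_eq_omegaMinus C.smooth_σ hC.closed, hC.regular_iff hpred⟩
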